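/- Throughout, a thin concurrent game $A$ is an event structure with polarity, equipped with a symmetry $\cong_A$ (an isomorphism family of polarity-preserving bijections between finite configurations) and two sub-isomorphism-families $\cong_A^+,\cong_A^-$ with only identities in common, where $\cong^+_A$ (resp. $\cong^-_A$) is closed under extensions in $\cong_A$ by pairs of positive (resp. negative) events. Let $A,B,C$ be thin concurrent games and let $\sigma:S\to A^\perp\parallel B$ and $\tau:T\to B^\perp\parallel C$ be strategies (maps of event structures with symmetry and polarity that are receptive, courteous, $\sim$-receptive, with $S,T$ thin). For a configuration $x^S$ of $S$ write $\sigma x^S=x^S_A\parallel x^S_B$; similarly $\tau x^T=x^T_B\parallel x^T_C$, and likewise for symmetries. A bijection between ordered sets is secured if the relation induced on its graph by the orders of its source and target is acyclic. A configuration is $+$-covered if all its maximal events are positive. For each of the games fix a representative $\underline{\mathsf x}\in\mathsf x$ of every symmetry class $\mathsf x$ of configurations (for instance a canonical one, if the games are representable). Let $\mathsf x_A,\mathsf x_B,\mathsf x_C$ be symmetry classes of configurations of $A,B,C$. * $\sim^+\text{-}\mathrm{wit}^+_\sigma(\mathsf x_A,\mathsf x_B)$ is the set of triples $(\theta^A_-,x^S,\theta^B_+)$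 with $x^S$ a $+$-covered configuration of $S$, $\theta^A_-:x^S_A\cong_A^-\underline{\mathsf x}_A$ and $\theta^B_+:x^S_B\cong_B^+\underline{\mathsf x}_B$; similarly for $\tau$. * $\sim^+\text{-}\mathrm{wit}^+_\sigma(\mathsf x_A,\mathsf x_B)\bullet\sim^+\text{-}\mathrm{wit}^+_\tau(\mathsf x_B,\mathsf x_C)$ is the set of pairs $((\theta^A_-,x^S,\theta^B_+),(\Omega^B_-,x^T,\Omega^C_+))$ that are causally compatible: the composite bijection $x^S\parallel x^T_C\simeq x^S_A\parallel x^S_B\parallel x^T_C\simeq x^S_A\parallel x^T_B\parallel x^T_C\simeq x^S_A\parallel x^T$ given by $\sigma$, by $(\Omega^B_-)^{-1}\circ\theta^B_+$ and by $\tau^{-1}$ is secured. * A configuration $y^T\circledast y^S$ of the interaction $T\circledast S$ is a pair of configurations with $y^S_B=y^T_B$ ($=y_B$) such that the induced bijection $y^S\parallel y^T_C\simeq y^S_A\parallel y^T$ is secured; it is $+$-covered if every maximal event for the induced causal order projects to a positive event of $A^\perp$ or $C$ (events projecting to $B$ are neutral). Then $\sim^+\text{-}\mathrm{int}^+_{\tau\circledast\sigma}(\mathsf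 x_A,\mathsf x_B,\mathsf x_C)$ is the set of triples $(\psi^A_-,y^T\circledast y^S,\psi^C_+)$ with $y^T\circledast y^S$ $+$-covered, $\psi^A_-:y^S_A\cong_A^-\underline{\mathsf x}_A$, $y_B\cong_B\underline{\mathsf x}_B$ and $\psi^C_+:y^T_C\cong_C^+\underline{\mathsf x}_C$. * $\mathrm{Sym}(\mathsf x_B)$ is the set of symmetries $\underline{\mathsf x}_B\cong_B\underline{\mathsf x}_B$. Fix, for every $x\in\mathsf x_B$, some $\kappa_x:x\cong_B\underline{\mathsf x}_B$, and write $\varphi[x,y]=\kappa_y^{-1}\circ\varphi\circ\kappa_x:x\cong_B y$ for $\varphi\in\mathrm{Sym}(\mathsf x_B)$ and $x,y\in\mathsf x_B$. **Corollary.** There is a bijection $$\Upsilon:\ \sim^+\text{-}\mathrm{wit}^+_\sigma(\mathsf x_A,\mathsf x_B)\bullet\sim^+\text{-}\mathrm{wit}^+_\tau(\mathsf x_B,\mathsf x_C)\ \to\ \sim^+\text{-}\mathrm{int}^+_{\tau\circledast\sigma}(\mathsf x_A,\mathsf x_B,\mathsf x_C)\times\mathrm{Sym}(\mathsf x_B)$$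 such that for every causally compatible pair $(\mathsf w_1,\mathsf w_2)=((\theta^A_-,x^S,\theta^B_+),(\Omega^B_-,x^T,\Omega^C_+))$, writing $((\psi^A_-,y^T\circledast y^S,\psi^C_+),\varphi)=\Upsilon(\mathsf w_1,\mathsf w_2)$, $y_B=y^S_B=y^T_B$ and $\Theta_B=\varphi[\underline{\mathsf x}_B,y_B]$, there are symmetries $\omega^S:x^S\cong_S y^S$ and $\nu^T:x^T\cong_T y^T$ with $$\psi^A_-\circ\omega^S_A=\theta^A_-,\qquad \Theta_B\circ\theta^B_+=\omega^S_B,\qquad \Theta_B\circ\Omega^B_-=\nu^T_B,\qquad \psi^C_+\circ\nu^T_C=\Omega^C_+ .$$ -/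

import Mathlib

open scoped SetRel

universe u v

/-! ### Event structures with polarity -/

/-- Polarity of a move: `neg` for Opponent, `pos` for Player. -/
inductive Polarity
  | neg
  | pos

/-- Exchange of the two players. -/
def Polarity.dual : Polarity → Polarity
  | .neg => .pos
  | .pos => .neg

/-- Event structures with polarity: a partial order of events with finite causes, a consistency
predicate on finite sets of events, and a polarity function. -/
structure ESP where
  E : Type*
  [order : PartialOrder E]
  /-- the consistent sets -/
  Con : Set (Set E)
  pol : E → Polarity
  finite_causes : ∀ e : E, (Set.Iic e).Finite
  con_finite : ∀ X ∈ Con, X.Finite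
  con_empty : ∅ ∈ Con
  con_singleton : ∀ e : E, {e} ∈ Con
  con_subset : ∀ X ∈ Con, ∀ Y ⊆ X, Y ∈ Con
  con_insert : ∀ X ∈ Con, ∀ e' ∈ X, ∀ e ≤ e', insert e X ∈ Con

attribute [instance] ESP.order

namespace ESP

/-- (Finite) configurations: consistent down-closed sets of events. -/
def IsConf (S : ESP) (x : Set S.E) : Prop := x ∈ S.Con ∧ IsLowerSet x

/-- The type of configurations. -/
def Conf (S : ESP) := {x : Set S.E // S.IsConf x}

/-- A configuration is `+`-covered when all its maximal events are positive. -/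
def PCovered (S : ESP) (x : S.Conf) : Prop :=
  ∀ s, Maximal (· ∈ x.1) s → S.pol s = .pos

/-- The same event structure with the polarities exchanged. -/
@[reducible] def dual (A : ESP) : ESP where
  E := A.E
  Con := A.Con
  pol e := (A.pol e).dual
  finite_causes := A.finite_causes
  con_finite := A.con_finite
  con_empty := A.con_empty
  con_singleton := A.con_singleton
  con_subset := A.con_subset
  con_insert := A.con_insert

/-- Parallel composition: disjoint union, where a set of events is consistent when both of its
components are. The order on the sum type leaves the two components incomparable. -/
@[reducible] def par (A B : ESP) : ESP where
  E := A.E ⊕ B.E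
  Con := {X | Sum.inl ⁻¹' X ∈ A.Con ∧ Sum.inr ⁻¹' X ∈ B.Con}
  pol := Sum.elim A.pol B.pol
  finite_causes := by
    rintro (a | b)
    · refine ((A.finite_causes a).image Sum.inl).subset ?_
      rintro (e | e) h
      · exact ⟨e, by simpa using h, rfl⟩
      · simp at h
    · refine ((B.finite_causes b).image Sum.inr).subset ?_
      rintro (e | e) h
      · simp at h
      · exact ⟨e, by simpa using h, rfl⟩
  con_finite := by
    rintro X ⟨hA, hB⟩
    refine (((A.con_finite _ hA).image Sum.inl).union ((B.con_finite _ hB).image Sum.inr)).subset ?_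
    rintro (e | e) h
    · exact Or.inl ⟨e, h, rfl⟩
    · exact Or.inr ⟨e, h, rfl⟩
  con_empty := ⟨A.con_empty, B.con_empty⟩
  con_singleton := by
    rintro (a | b)
    · exact ⟨A.con_subset _ (A.con_singleton a) _ (by intro e h; simpa using h),
        B.con_subset _ B.con_empty _ (by intro e h; simp at h)⟩
    · exact ⟨A.con_subset _ A.con_empty _ (by intro e h; simp at h),
        B.con_subset _ (B.con_singleton b) _ (by intro e h; simpa using h)⟩
  con_subset := fun X hX Y hY =>
    ⟨A.con_subset _ hX.1 _ (Set.preimage_mono hY), B.con_subset _ hX.2 _ (Set.preimage_mono hY)⟩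
  con_insert := by
    rintro X ⟨hA, hB⟩ (a' | b') h (a | b) hle
    · exact ⟨A.con_subset _ (A.con_insert _ hA a' h a (by simpa using hle)) _
          (by intro e h; simpa using h), B.con_subset _ hB _ (by intro e h; simpa using h)⟩
    · simp at hle
    · simp at hle
    · exact ⟨A.con_subset _ hA _ (by intro e h; simpa using h),
        B.con_subset _ (B.con_insert _ hB b' h b (by simpa using hle)) _
          (by intro e h; simpa using h)⟩

/-- The component `x_A` of a configuration `x_A ∥ x_B` of `A ∥ B`. -/
def Conf.fst {A B : ESP} (x : (A.par B).Conf) : A.Conf :=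
  ⟨Sum.inl ⁻¹' x.1, x.2.1.1, fun _ _ h hx => x.2.2 (Sum.inl_le_inl_iff.2 h) hx⟩

/-- The component `x_B` of a configuration `x_A ∥ x_B` of `A ∥ B`. -/
def Conf.snd {A B : ESP} (x : (A.par B).Conf) : B.Conf :=
  ⟨Sum.inr ⁻¹' x.1, x.2.1.2, fun _ _ h hx => x.2.2 (Sum.inr_le_inr_iff.2 h) hx⟩

end ESP

/-! ### Isomorphism families

A bijection `θ` between two configurations is represented by its graph, a set of pairs of events;
its source is `θ.dom` and its target is `θ.cod`. Composition `θ ○ θ'` is in diagrammatic order: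
first `θ`, then `θ'`. -/

/-- The graph of the identity on a set. -/
def idGraph {E : Type*} (x : Set E) : SetRel E E := {p | p.1 ∈ x ∧ p.1 = p.2}

/-- The bijection `θ` lies in the family `F` and goes from `x` to `y`. -/
def ESP.Via {S : ESP} (F : Set (SetRel S.E S.E)) (θ : SetRel S.E S.E) (x y : S.Conf) : Prop :=
  θ ∈ F ∧ θ.dom = x.1 ∧ θ.cod = y.1

/-- Isomorphism families: sets of bijections between configurations that form a groupoid and are
closed under restriction and (non-unique) extension. -/
structure IsIsoFamily (S : ESP) (F : Set (SetRel S.E S.E)) : Prop where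
  conf_dom : ∀ θ ∈ F, S.IsConf θ.dom
  conf_cod : ∀ θ ∈ F, S.IsConf θ.cod
  functional : ∀ θ ∈ F, ∀ p ∈ θ, ∀ q ∈ θ, p.1 = q.1 → p = q
  injective : ∀ θ ∈ F, ∀ p ∈ θ, ∀ q ∈ θ, p.2 = q.2 → p = q
  id_mem : ∀ x, S.IsConf x → idGraph x ∈ F
  inv_mem : ∀ θ ∈ F, θ.inv ∈ F
  comp_mem : ∀ θ ∈ F, ∀ θ' ∈ F, θ.cod = θ'.dom → θ ○ θ' ∈ F
  restrict : ∀ θ ∈ F, ∀ x, S.IsConf x → x ⊆ θ.dom → {p ∈ θ | p.1 ∈ x} ∈ F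
  extend : ∀ θ ∈ F, ∀ x, S.IsConf x → θ.dom ⊆ x → ∃ θ' ∈ F, θ ⊆ θ' ∧ θ'.dom = x

/-- Left component of a relation on a sum type. -/
def relFst {α β : Type*} (θ : SetRel (α ⊕ β) (α ⊕ β)) : SetRel α α :=
  {p | (Sum.inl p.1, Sum.inl p.2) ∈ θ}

/-- Right component of a relation on a sum type. -/
def relSnd {α β : Type*} (θ : SetRel (α ⊕ β) (α ⊕ β)) : SetRel β β :=
  {p | (Sum.inr p.1, Sum.inr p.2) ∈ θ}

/-- The bijections `θ_A ∥ θ_B` with `θ_A ∈ F` and `θ_B ∈ G`. -/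
def parFamily {α β : Type*} (F : Set (SetRel α α)) (G : Set (SetRel β β)) :
    Set (SetRel (α ⊕ β) (α ⊕ β)) :=
  {θ | (∀ p ∈ θ, p.1.isLeft = p.2.isLeft) ∧ relFst θ ∈ F ∧ relSnd θ ∈ G}

theorem ESP.isConf_par {A B : ESP} {X : Set (A.par B).E} :
    (A.par B).IsConf X ↔ A.IsConf (Sum.inl ⁻¹' X) ∧ B.IsConf (Sum.inr ⁻¹' X) := by
  constructor
  · intro h
    exact ⟨(ESP.Conf.fst ⟨X, h⟩).2, (ESP.Conf.snd ⟨X, h⟩).2⟩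
  · rintro ⟨⟨h1, h2⟩, h3, h4⟩
    refine ⟨⟨h1, h3⟩, ?_⟩
    rintro (a | b) (a' | b') hle h
    · exact h2 (Sum.inl_le_inl_iff.1 hle) h
    · exact absurd hle Sum.not_inr_le_inl
    · exact absurd hle Sum.not_inl_le_inr
    · exact h4 (Sum.inr_le_inr_iff.1 hle) h

theorem relFst_dom {α β : Type*} {θ : SetRel (α ⊕ β) (α ⊕ β)}
    (h : ∀ p ∈ θ, p.1.isLeft = p.2.isLeft) : (relFst θ).dom = Sum.inl ⁻¹' θ.dom := by
  ext a
  constructor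
  · rintro ⟨a', h'⟩
    exact ⟨_, h'⟩
  · rintro ⟨a' | b', h'⟩
    · exact ⟨a', h'⟩
    · simpa using h _ h'

theorem relSnd_dom {α β : Type*} {θ : SetRel (α ⊕ β) (α ⊕ β)}
    (h : ∀ p ∈ θ, p.1.isLeft = p.2.isLeft) : (relSnd θ).dom = Sum.inr ⁻¹' θ.dom := by
  ext a
  constructor
  · rintro ⟨a', h'⟩
    exact ⟨_, h'⟩
  · rintro ⟨a' | b', h'⟩
    · simpa using h _ h'
    · exact ⟨b', h'⟩

theorem relFst_cod {α β : Type*} {θ : SetRel (α ⊕ β) (α ⊕ β)}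
    (h : ∀ p ∈ θ, p.1.isLeft = p.2.isLeft) : (relFst θ).cod = Sum.inl ⁻¹' θ.cod :=
  relFst_dom (θ := θ.inv) fun p hp => (h p.swap hp).symm

theorem relSnd_cod {α β : Type*} {θ : SetRel (α ⊕ β) (α ⊕ β)}
    (h : ∀ p ∈ θ, p.1.isLeft = p.2.isLeft) : (relSnd θ).cod = Sum.inr ⁻¹' θ.cod :=
  relSnd_dom (θ := θ.inv) fun p hp => (h p.swap hp).symm

/-- The bijections `θ_A ∥ θ_B` form an isomorphism family on the parallel composition. -/
theorem IsIsoFamily.par {A B : ESP} {F : Set (SetRel A.E A.E)} {G : Set (SetRel B.E B.E)}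
    (hF : IsIsoFamily A F) (hG : IsIsoFamily B G) :
    IsIsoFamily (A.par B) (parFamily F G) where
  conf_dom := by
    rintro θ ⟨h, h1, h2⟩
    exact ESP.isConf_par.2 ⟨relFst_dom h ▸ hF.conf_dom _ h1, relSnd_dom h ▸ hG.conf_dom _ h2⟩
  conf_cod := by
    rintro θ ⟨h, h1, h2⟩
    exact ESP.isConf_par.2 ⟨relFst_cod h ▸ hF.conf_cod _ h1, relSnd_cod h ▸ hG.conf_cod _ h2⟩
  functional := by
    rintro θ ⟨h, h1, h2⟩ ⟨p1 | p1, p2 | p2⟩ hp ⟨q1 | q1, q2 | q2⟩ hq e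
    all_goals first
      | (simpa using h _ hp)
      | (simpa using h _ hq)
      | (simp at e; done)
      | skip
    · have := hF.functional _ h1 (p1, p2) hp (q1, q2) hq (by simpa using e)
      simp_all
    · have := hG.functional _ h2 (p1, p2) hp (q1, q2) hq (by simpa using e)
      simp_all
  injective := by
    rintro θ ⟨h, h1, h2⟩ ⟨p1 | p1, p2 | p2⟩ hp ⟨q1 | q1, q2 | q2⟩ hq e
    all_goals first
      | (simpa using h _ hp)
      | (simpa using h _ hq)
      | (simp at e; done)
      | skip
    · have := hF.injective _ h1 (p1, p2) hp (q1, q2) hq (by simpa using e)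
      simp_all
    · have := hG.injective _ h2 (p1, p2) hp (q1, q2) hq (by simpa using e)
      simp_all
  id_mem := by
    intro x hx
    obtain ⟨hA, hB⟩ := ESP.isConf_par.1 hx
    refine ⟨fun p hp => by rw [hp.2], ?_, ?_⟩
    · convert hF.id_mem _ hA using 1
      ext p
      simp [relFst, idGraph]
    · convert hG.id_mem _ hB using 1
      ext p
      simp [relSnd, idGraph]
  inv_mem := by
    rintro θ ⟨h, h1, h2⟩
    exact ⟨fun p hp => (h p.swap hp).symm, hF.inv_mem _ h1, hG.inv_mem _ h2⟩
  comp_mem := by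
    rintro θ ⟨h, h1, h2⟩ θ' ⟨h', h1', h2'⟩ e
    refine ⟨?_, ?_, ?_⟩
    · rintro ⟨p, q⟩ ⟨m, hm, hm'⟩
      exact (h _ hm).trans (h' _ hm')
    · convert hF.comp_mem _ h1 _ h1' (by rw [relFst_cod h, relFst_dom h', e]) using 1
      ext ⟨p, q⟩
      constructor
      · rintro ⟨m | m, hm, hm'⟩
        · exact ⟨m, hm, hm'⟩
        · simpa using h _ hm
      · rintro ⟨m, hm, hm'⟩
        exact ⟨_, hm, hm'⟩
    · convert hG.comp_mem _ h2 _ h2' (by rw [relSnd_cod h, relSnd_dom h', e]) using 1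
      ext ⟨p, q⟩
      constructor
      · rintro ⟨m | m, hm, hm'⟩
        · simpa using h _ hm
        · exact ⟨m, hm, hm'⟩
      · rintro ⟨m, hm, hm'⟩
        exact ⟨_, hm, hm'⟩
  restrict := by
    rintro θ ⟨h, h1, h2⟩ x hx hs
    obtain ⟨hA, hB⟩ := ESP.isConf_par.1 hx
    exact ⟨fun p hp => h p hp.1,
      hF.restrict _ h1 _ hA (by rw [relFst_dom h]; exact Set.preimage_mono hs),
      hG.restrict _ h2 _ hB (by rw [relSnd_dom h]; exact Set.preimage_mono hs)⟩
  extend := by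
    rintro θ ⟨h, h1, h2⟩ x hx hs
    obtain ⟨hA, hB⟩ := ESP.isConf_par.1 hx
    obtain ⟨θA, hθA, hA1, hA2⟩ :=
      hF.extend _ h1 _ hA (by rw [relFst_dom h]; exact Set.preimage_mono hs)
    obtain ⟨θB, hθB, hB1, hB2⟩ :=
      hG.extend _ h2 _ hB (by rw [relSnd_dom h]; exact Set.preimage_mono hs)
    have hl : ∀ p ∈ (Prod.map Sum.inl Sum.inl '' θA ∪ Prod.map Sum.inr Sum.inr '' θB :
        SetRel (A.E ⊕ B.E) (A.E ⊕ B.E)), p.1.isLeft = p.2.isLeft := by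
      rintro _ (⟨p, _, rfl⟩ | ⟨p, _, rfl⟩) <;> rfl
    have e1 : relFst (Prod.map Sum.inl Sum.inl '' θA ∪ Prod.map Sum.inr Sum.inr '' θB :
        SetRel (A.E ⊕ B.E) (A.E ⊕ B.E)) = θA := by
      ext ⟨p, q⟩; simp [relFst]
    have e2 : relSnd (Prod.map Sum.inl Sum.inl '' θA ∪ Prod.map Sum.inr Sum.inr '' θB :
        SetRel (A.E ⊕ B.E) (A.E ⊕ B.E)) = θB := by
      ext ⟨p, q⟩; simp [relSnd]
    refine ⟨_, ⟨hl, by rwa [e1], by rwa [e2]⟩, ?_, ?_⟩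
    · rintro ⟨p | p, q | q⟩ hp
      · exact Or.inl ⟨(p, q), hA1 hp, rfl⟩
      · simpa using h _ hp
      · simpa using h _ hp
      · exact Or.inr ⟨(p, q), hB1 hp, rfl⟩
    · ext (a | b)
      · have := relFst_dom hl
        rw [e1, hA2] at this
        exact (Set.ext_iff.1 this a).symm
      · have := relSnd_dom hl
        rw [e2, hB2] at this
        exact (Set.ext_iff.1 this b).symm

/-! ### Thin concurrent games -/

/-- Event structures with symmetry and polarity: the symmetry is an isomorphism family of
polarity-preserving bijections. -/
structure ESSP extends ESP where
  sym : Set (SetRel E E)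
  sym_family : IsIsoFamily toESP sym
  sym_pol : ∀ θ ∈ sym, ∀ p ∈ θ, pol p.1 = pol p.2

/-- Thin concurrent games: an event structure with symmetry and polarity, with two sub-symmetries,
positive and negative, sharing only identities, and such that the positive (resp. negative)
symmetry absorbs the extensions of its members by pairs of positive (resp. negative) events. -/
structure TCG extends ESSP where
  symP : Set (SetRel E E)
  symN : Set (SetRel E E)
  symP_family : IsIsoFamily toESP symP
  symN_family : IsIsoFamily toESP symN
  symP_subset : symP ⊆ sym
  symN_subset : symN ⊆ sym
  inter_id : ∀ θ ∈ symP, θ ∈ symN → ∀ p ∈ θ, p.1 = p.2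
  symP_ext : ∀ θ ∈ symP, ∀ θ' ∈ sym, θ ⊆ θ' → (∀ p ∈ θ' \ θ, pol p.1 = .pos) → θ' ∈ symP
  symN_ext : ∀ θ ∈ symN, ∀ θ' ∈ sym, θ ⊆ θ' → (∀ p ∈ θ' \ θ, pol p.1 = .neg) → θ' ∈ symN

theorem IsIsoFamily.dual {A : ESP} {F : Set (SetRel A.E A.E)} (h : IsIsoFamily A F) :
    IsIsoFamily A.dual F where
  conf_dom := h.conf_dom
  conf_cod := h.conf_cod
  functional := h.functional
  injective := h.injective
  id_mem := h.id_mem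
  inv_mem := h.inv_mem
  comp_mem := h.comp_mem
  restrict := h.restrict
  extend := h.extend

namespace TCG

/-- The dual game `A^⊥`: polarities are exchanged, and so are the two sub-symmetries. -/
@[reducible] def dual (A : TCG) : TCG where
  toESP := A.toESP.dual
  sym := A.sym
  sym_family := A.sym_family.dual
  sym_pol := fun θ h p hp => congrArg Polarity.dual (A.sym_pol θ h p hp)
  symP := A.symN
  symN := A.symP
  symP_family := A.symN_family.dual
  symN_family := A.symP_family.dual
  symP_subset := A.symN_subset
  symN_subset := A.symP_subset
  inter_id := fun θ h h' => A.inter_id θ h' h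
  symP_ext := fun θ h θ' h' hs hp => A.symN_ext θ h θ' h' hs fun p hm => by
    have := hp p hm
    revert this
    cases h : A.pol p.1 <;> simp [Polarity.dual, h]
  symN_ext := fun θ h θ' h' hs hp => A.symP_ext θ h θ' h' hs fun p hm => by
    have := hp p hm
    revert this
    cases h : A.pol p.1 <;> simp [Polarity.dual, h]

/-- The parallel composition `A ∥ B` of games. -/
@[reducible] def par (A B : TCG) : TCG where
  toESP := A.toESP.par B.toESP
  sym := parFamily A.sym B.sym
  sym_family := A.sym_family.par B.sym_family
  sym_pol := by
    rintro θ ⟨h, h1, h2⟩ ⟨p | p, q | q⟩ hp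
    · exact A.sym_pol _ h1 (p, q) hp
    · simpa using h _ hp
    · simpa using h _ hp
    · exact B.sym_pol _ h2 (p, q) hp
  symP := parFamily A.symP B.symP
  symN := parFamily A.symN B.symN
  symP_family := A.symP_family.par B.symP_family
  symN_family := A.symN_family.par B.symN_family
  symP_subset := fun _ h => ⟨h.1, A.symP_subset h.2.1, B.symP_subset h.2.2⟩
  symN_subset := fun _ h => ⟨h.1, A.symN_subset h.2.1, B.symN_subset h.2.2⟩
  inter_id := by
    rintro θ ⟨h, h1, h2⟩ ⟨_, h1', h2'⟩ ⟨p | p, q | q⟩ hp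
    · exact congrArg Sum.inl (A.inter_id _ h1 h1' (p, q) hp)
    · simpa using h _ hp
    · simpa using h _ hp
    · exact congrArg Sum.inr (B.inter_id _ h2 h2' (p, q) hp)
  symP_ext := by
    rintro θ ⟨h, h1, h2⟩ θ' ⟨h', h1', h2'⟩ hs hp
    exact ⟨h', A.symP_ext _ h1 _ h1' (fun p hm => hs hm) fun p hm => hp (.inl p.1, .inl p.2) hm,
      B.symP_ext _ h2 _ h2' (fun p hm => hs hm) fun p hm => hp (.inr p.1, .inr p.2) hm⟩
  symN_ext := by
    rintro θ ⟨h, h1, h2⟩ θ' ⟨h', h1', h2'⟩ hs hp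
    exact ⟨h', A.symN_ext _ h1 _ h1' (fun p hm => hs hm) fun p hm => hp (.inl p.1, .inl p.2) hm,
      B.symN_ext _ h2 _ h2' (fun p hm => hs hm) fun p hm => hp (.inr p.1, .inr p.2) hm⟩

/-- Two configurations are symmetric when some symmetry goes from one to the other. -/
def symSetoid (A : TCG) : Setoid A.Conf where
  r x y := ∃ θ, ESP.Via A.sym θ x y
  iseqv :=
    { refl := fun x => ⟨idGraph x.1, A.sym_family.id_mem _ x.2,
        by ext a; simp [idGraph], by ext a; simp [idGraph]⟩
      symm := by
        rintro x y ⟨θ, h, h1, h2⟩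
        exact ⟨θ.inv, A.sym_family.inv_mem _ h, h2, h1⟩
      trans := by
        rintro x y z ⟨θ, h, h1, h2⟩ ⟨θ', h', h1', h2'⟩
        have e : θ.cod = θ'.dom := h2.trans h1'.symm
        refine ⟨θ ○ θ', A.sym_family.comp_mem _ h _ h' e, ?_, ?_⟩
        · rw [← h1]
          ext a
          constructor
          · rintro ⟨c, b, hb, _⟩
            exact ⟨b, hb⟩
          · rintro ⟨b, hb⟩
            obtain ⟨c, hc⟩ : b ∈ θ'.dom := e ▸ ⟨a, hb⟩
            exact ⟨c, b, hb, hc⟩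
        · rw [← h2']
          ext c
          constructor
          · rintro ⟨a, b, _, hc⟩
            exact ⟨b, hc⟩
          · rintro ⟨b, hc⟩
            obtain ⟨a, hb⟩ : b ∈ θ.cod := e ▸ ⟨c, hc⟩
            exact ⟨a, b, hb, hc⟩ }

/-- Symmetry classes of configurations. -/
def SymClass (A : TCG) := Quotient A.symSetoid

/-- The symmetry class of a configuration. -/
def symClass (A : TCG) (x : A.Conf) : A.SymClass := Quotient.mk A.symSetoid x

/-- The group of endosymmetries of a configuration (its underlying set). -/
def EndoSym (A : TCG) (x : A.Conf) := {θ : SetRel A.E A.E // ESP.Via A.sym θ x x}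

end TCG

/-! ### Strategies -/

/-- Strategies on a thin concurrent game `A`: maps of event structures with symmetry and polarity
into `A` that are receptive, courteous, `∼`-receptive and whose symmetry is thin. -/
structure Strategy (A : TCG.{u}) where
  S : ESSP.{v}
  map : S.E → A.E
  map_conf : ∀ x, S.IsConf x → A.IsConf (map '' x)
  map_injOn : ∀ x, S.IsConf x → Set.InjOn map x
  map_pol : ∀ s, A.pol (map s) = S.pol s
  map_sym : ∀ θ ∈ S.sym, Prod.map map map '' θ ∈ A.sym
  receptive : ∀ x, S.IsConf x → ∀ a ∉ map '' x, A.pol a = .neg → A.IsConf (insert a (map '' x)) →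
    ∃! s, map s = a ∧ S.IsConf (insert s x)
  courteous : ∀ s s', s ⋖ s' → S.pol s = .pos ∨ S.pol s' = .neg → map s ⋖ map s'
  sim_receptive : ∀ θ ∈ S.sym, ∀ p ∉ Prod.map map map '' θ, A.pol p.1 = .neg →
    insert p (Prod.map map map '' θ) ∈ A.sym →
    ∃! q, Prod.map map map q = p ∧ insert q θ ∈ S.sym
  thin : ∀ θ ∈ S.sym, ∀ s ∉ θ.dom, S.pol s = .pos → S.IsConf (insert s θ.dom) →
    ∃! s', insert (s, s') θ ∈ S.sym

namespace Strategy

/-- The image `σ x` of a configuration. -/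
def image {A : TCG} (σ : Strategy A) (x : σ.S.Conf) : A.Conf := ⟨σ.map '' x.1, σ.map_conf _ x.2⟩

/-- The image `σ θ` of a symmetry. -/
def imageSym {A : TCG} (σ : Strategy A) (θ : SetRel σ.S.E σ.S.E) : SetRel A.E A.E :=
  Prod.map σ.map σ.map '' θ

variable {A B : TCG} (σ : Strategy (A.dual.par B))

/-- For `σ` a strategy from `A` to `B` (that is, on `A^⊥ ∥ B`), the component `x_A` of
`σ x = x_A ∥ x_B`. -/
def left (x : σ.S.Conf) : A.Conf := (σ.image x).fst

/-- The component `x_B` of `σ x = x_A ∥ x_B`. -/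
def right (x : σ.S.Conf) : B.Conf := (σ.image x).snd

/-- The component `θ_A` of `σ θ = θ_A ∥ θ_B`. -/
def leftSym (θ : SetRel σ.S.E σ.S.E) : SetRel A.E A.E := relFst (σ.imageSym θ)

/-- The component `θ_B` of `σ θ = θ_A ∥ θ_B`. -/
def rightSym (θ : SetRel σ.S.E σ.S.E) : SetRel B.E B.E := relSnd (σ.imageSym θ)

end Strategy

/-! ### Causal compatibility and interaction -/

/-- One step of the causal relation induced on the graph of a bijection between two ordered sets
by the orders of its source and of its target. -/
def CausalStep {X Y : Type*} [Preorder X] [Preorder Y] (φ : SetRel X Y) (p q : X × Y) : Prop :=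
  p ∈ φ ∧ q ∈ φ ∧ (p.1 < q.1 ∨ p.2 < q.2)

/-- A bijection is secured when its induced causal relation is acyclic. -/
def Secured {X Y : Type*} [Preorder X] [Preorder Y] (φ : SetRel X Y) : Prop :=
  ∀ p, ¬ Relation.TransGen (CausalStep φ) p p

section Interaction

variable {A B C : TCG} (σ : Strategy (A.dual.par B)) (τ : Strategy (B.dual.par C))

/-- The composite bijection `x^S ∥ x^T_C ≃ x^S_A ∥ x^S_B ∥ x^T_C ≃ x^S_A ∥ x^T_B ∥ x^T_C ≃ x^S_A ∥ x^T`
given by `σ`, by `θ : x^S_B ≃ x^T_B` and by the inverse of `τ`. -/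
def syncGraph (xS : σ.S.Conf) (xT : τ.S.Conf) (θ : SetRel B.E B.E) :
    SetRel (σ.S.E ⊕ C.E) (A.E ⊕ τ.S.E) :=
  {p | (∃ s ∈ xS.1, ∃ a : A.E, σ.map s = Sum.inl a ∧ p = (Sum.inl s, Sum.inl a)) ∨
    (∃ s ∈ xS.1, ∃ t ∈ xT.1, ∃ b b' : B.E, σ.map s = Sum.inr b ∧ (b, b') ∈ θ ∧
      τ.map t = Sum.inl b' ∧ p = (Sum.inl s, Sum.inr t)) ∨
    (∃ t ∈ xT.1, ∃ c : C.E, τ.map t = Sum.inr c ∧ p = (Sum.inr c, Sum.inr t))}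

/-- Configurations `x^T ⊛ x^S` of the interaction `T ⊛ S`: pairs of configurations that agree on
`B` and are causally compatible. -/
@[ext] structure IntConf where
  xS : σ.S.Conf
  xT : τ.S.Conf
  matching : σ.right xS = τ.left xT
  compatible : Secured (syncGraph σ τ xS xT (idGraph (σ.right xS).1))

variable {σ τ}

/-- The events of `x^T ⊛ x^S`: those of the bijection between `x^S ∥ x_C` and `x_A ∥ x^T`, ordered by
its induced causal relation. -/
def IntConf.events (z : IntConf σ τ) : SetRel (σ.S.E ⊕ C.E) (A.E ⊕ τ.S.E) :=
  syncGraph σ τ z.xS z.xT (idGraph (σ.right z.xS).1)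

variable (σ τ) in
/-- The positive events of an interaction are those sent to a positive event of `A^⊥` or `C`;
the synchronized events, in `B`, are neither positive nor negative. -/
def IntPositive : (σ.S.E ⊕ C.E) × (A.E ⊕ τ.S.E) → Prop
  | (_, Sum.inl a) => A.dual.pol a = .pos
  | (Sum.inr c, Sum.inr _) => C.pol c = .pos
  | (Sum.inl _, Sum.inr _) => False

/-- `x^T ⊛ x^S` is `+`-covered when all its maximal events are positive. -/
def IntConf.PCovered (z : IntConf σ τ) : Prop :=
  ∀ p ∈ z.events, (∀ q, ¬ CausalStep z.events p q) → IntPositive σ τ p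

/-! ### Witnesses -/

/-- `+`-covered witnesses `(θ_A, x, θ_B)` of a strategy from `A` to `B`, together with a negative
symmetry from `x_A` to the representative `rA` and a positive symmetry from `x_B` to `rB`. -/
@[ext] structure SimWit {A B : TCG} (σ : Strategy (A.dual.par B)) (rA : A.Conf) (rB : B.Conf) where
  θA : SetRel A.E A.E
  x : σ.S.Conf
  θB : SetRel B.E B.E
  covered : σ.S.PCovered x
  neg : ESP.Via A.symN θA (σ.left x) rA
  pos : ESP.Via B.symP θB (σ.right x) rB

/-- A pair of witnesses is causally compatible when the composite bijection induced by the
symmetry from `x^S_B` to `x^T_B` (through the representative in `B`) is secured. -/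
def CausallyCompatible {rA : A.Conf} {rB : B.Conf} {rC : C.Conf}
    (w₁ : SimWit σ rA rB) (w₂ : SimWit τ rB rC) : Prop :=
  Secured (syncGraph σ τ w₁.x w₂.x (w₁.θB ○ w₂.θA.inv))

variable (σ τ) in
/-- Causally compatible pairs of witnesses. -/
def CompatiblePairs (rA : A.Conf) (rB : B.Conf) (rC : C.Conf) :=
  {w : SimWit σ rA rB × SimWit τ rB rC // CausallyCompatible w.1 w.2}

variable (σ τ) in
/-- `+`-covered witnesses `(ψ_A, y^T ⊛ y^S, ψ_C)` of the interaction, where `y_B` is symmetric to the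
representative `rB`, together with a negative symmetry from `y_A` to `rA` and a positive symmetry
from `y_C` to `rC`. -/
@[ext] structure SimInt (rA : A.Conf) (rB : B.Conf) (rC : C.Conf) where
  ψA : SetRel A.E A.E
  y : IntConf σ τ
  ψC : SetRel C.E C.E
  covered : y.PCovered
  neg : ESP.Via A.symN ψA (σ.left y.xS) rA
  mid : ∃ θ, ESP.Via B.sym θ (σ.right y.xS) rB
  pos : ESP.Via C.symP ψC (τ.right y.xT) rC

end Interaction

/-- The transport `φ[x, y] = κ_y⁻¹ ∘ φ ∘ κ_x` of an endosymmetry `φ` of a representative along a family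
`κ` of symmetries to the representative. -/
def transport {B : TCG} (κ : B.Conf → SetRel B.E B.E) (φ : SetRel B.E B.E) (x y : B.Conf) :
    SetRel B.E B.E :=
  κ x ○ φ ○ (κ y).inv

/-! Relate a compatible pair of witnesses to a pair `(z, Θ)`, with `Θ` a symmetry from `rB` to
`y_B`, when some `ω` and `ν` satisfy the four equations (`Related`). The theorem says that this
relation is the graph of a bijection; conjugation by the chosen `κ` then trades `Θ` for an
endosymmetry of `rB`.

From witnesses to the interaction. Let `θ` be the symmetry between the two projections to `B`.
Securedness allows `ω` and `ν` to be built one causally minimal event at a time, keeping them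
negative on `A`, positive on `C` and with matching images on `B` along `θ`
(`PartialLift.exists_total`). An event that a strategy plays positively is extended freely: on `A`
and `C` the relevant sub-symmetry absorbs it. An event it plays negatively follows a symmetry chosen
in the game, by ∼-receptivity. A synchronized event is positive for exactly one strategy, which
leads while the other follows. The result is unique, since a pair of symmetries out of an
interaction that agree on `B`, are negative on `A` and positive on `C` must be identities
(`IntConf.eq_of_sym`): along the causal order, thinness fixes positive events and receptivity fixes
negative ones.

From the interaction to witnesses. Any symmetry out of the image of a configuration of a strategy
factors as the image of a symmetry of the strategy followed by a positive symmetry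
(`Strategy.exists_factorization`). Applied to `(ψA, Θ⁻¹)` for `σ` and to `(Θ⁻¹, ψC)` for `τ`, this
yields the two witnesses. They are unique because a symmetry of a strategy with positive image is an
identity (`Strategy.eq_of_imageSym_symP`).

Covering by positive events passes between an interaction and its two components thanks to courtesy
(`IntConf.pCovered_iff`), and securedness is invariant under symmetry (`Secured.of_via`). -/

/-! ### Graphs of bijections -/

namespace SetRel

variable {α β γ : Type*}

theorem dom_insert_pair (a : α) (b : β) (θ : SetRel α β) :
    SetRel.dom (insert (a, b) θ) = insert a θ.dom := by
  ext c
  constructor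
  · rintro ⟨d, h | h⟩
    · exact Or.inl (congrArg Prod.fst h)
    · exact Or.inr ⟨d, h⟩
  · rintro (rfl | ⟨d, h⟩)
    · exact ⟨b, Or.inl rfl⟩
    · exact ⟨d, Or.inr h⟩

theorem inv_insert_pair (a : α) (b : β) (θ : SetRel α β) :
    SetRel.inv (insert (a, b) θ) = insert (b, a) θ.inv := by
  ext ⟨c, d⟩
  simp [SetRel.inv, Prod.ext_iff, and_comm]

theorem cod_insert_pair (a : α) (b : β) (θ : SetRel α β) :
    SetRel.cod (insert (a, b) θ) = insert b θ.cod := by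
  rw [← dom_inv, inv_insert_pair, dom_insert_pair, dom_inv]

/-- Injectivity of `θ` makes `θ ○ θ.inv` the identity on `θ.dom`. The cancellation laws of
isomorphism families all come from this law and its mirror image, applied to a member or to its
inverse. -/
theorem comp_inv_comp_cancel {θ : SetRel α β} {χ : SetRel α γ}
    (h : ∀ p ∈ θ, ∀ q ∈ θ, p.2 = q.2 → p = q) (hd : χ.dom ⊆ θ.dom) :
    θ ○ (θ.inv ○ χ) = χ := by
  ext ⟨a, c⟩
  constructor
  · rintro ⟨b, hb, a', ha', hc⟩
    cases h _ hb _ ha' rfl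
    exact hc
  · intro hc
    obtain ⟨b, hb⟩ := hd ⟨c, hc⟩
    exact ⟨b, hb, a, hb, hc⟩

theorem comp_comp_inv_cancel {θ : SetRel β γ} {χ : SetRel α β}
    (h : ∀ p ∈ θ, ∀ q ∈ θ, p.2 = q.2 → p = q) (hd : χ.cod ⊆ θ.dom) :
    (χ ○ θ) ○ θ.inv = χ := by
  ext ⟨a, c⟩
  constructor
  · rintro ⟨b, ⟨a', ha', hb⟩, hc⟩
    cases h _ hb _ hc rfl
    exact ha'
  · intro hc
    obtain ⟨b, hb⟩ := hd ⟨a, hc⟩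
    exact ⟨b, ⟨c, hc, hb⟩, hb⟩

theorem dom_comp_of_cod_subset {θ : SetRel α β} {χ : SetRel β γ} (h : θ.cod ⊆ χ.dom) :
    (θ ○ χ).dom = θ.dom := by
  ext a
  constructor
  · rintro ⟨c, b, hb, _⟩
    exact ⟨b, hb⟩
  · rintro ⟨b, hb⟩
    obtain ⟨c, hc⟩ := h ⟨a, hb⟩
    exact ⟨c, b, hb, hc⟩

theorem cod_comp_of_dom_subset {θ : SetRel α β} {χ : SetRel β γ} (h : χ.dom ⊆ θ.cod) :
    (θ ○ χ).cod = χ.cod := by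
  rw [← dom_inv, inv_comp]
  exact dom_comp_of_cod_subset h

/-- The disjoint union of two relations. -/
def sum {α' β' : Type*} (θ : SetRel α α') (χ : SetRel β β') : SetRel (α ⊕ β) (α' ⊕ β') :=
  Prod.map Sum.inl Sum.inl '' θ ∪ Prod.map Sum.inr Sum.inr '' χ

variable {α' β' : Type*} {θ : SetRel α α'} {χ : SetRel β β'}

@[simp] theorem inl_inl_mem_sum {a : α} {a' : α'} :
    (Sum.inl a, Sum.inl a') ∈ sum θ χ ↔ (a, a') ∈ θ := by
  simp [sum]

@[simp] theorem inr_inr_mem_sum {b : β} {b' : β'} :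
    (Sum.inr b, Sum.inr b') ∈ sum θ χ ↔ (b, b') ∈ χ := by
  simp [sum]

@[simp] theorem inl_inr_notMem_sum {a : α} {b' : β'} : (Sum.inl a, Sum.inr b') ∉ sum θ χ := by
  simp [sum]

@[simp] theorem inr_inl_notMem_sum {b : β} {a' : α'} : (Sum.inr b, Sum.inl a') ∉ sum θ χ := by
  simp [sum]

end SetRel

theorem idGraph_dom {E : Type*} (x : Set E) : (idGraph x).dom = x := by
  ext a; simp [idGraph]

theorem idGraph_cod {E : Type*} (x : Set E) : (idGraph x).cod = x := by
  ext a; simp [idGraph]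

/-! ### Isomorphism families -/

theorem Polarity.eq_pos_or_neg (p : Polarity) : p = .pos ∨ p = .neg := by
  cases p <;> simp

namespace ESP

theorem IsConf.subset_Iic {S : ESP} {x : Set S.E} (h : S.IsConf x) {s : S.E} (hs : s ∈ x) :
    Set.Iic s ⊆ x := fun _ hr => h.2 hr hs

theorem isConf_of_subset {S : ESP} {x y : Set S.E} (h : S.IsConf x) (hy : y ⊆ x)
    (hl : IsLowerSet y) : S.IsConf y := ⟨S.con_subset _ h.1 _ hy, hl⟩

theorem IsConf.finite {S : ESP} {x : Set S.E} (h : S.IsConf x) : x.Finite := S.con_finite _ h.1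

/-- Adding to a configuration contained in another one an event of the latter whose causes are
already there gives a configuration. -/
theorem isConf_insert {S : ESP} {x y : Set S.E} (hx : S.IsConf x) (hy : S.IsConf y) (h : y ⊆ x)
    {s : S.E} (hs : s ∈ x) (hl : ∀ r < s, r ∈ y) : S.IsConf (insert s y) := by
  refine isConf_of_subset hx (Set.insert_subset hs h) ?_
  rintro a b hab (rfl | ha)
  · rcases hab.lt_or_eq with h | h
    · exact Or.inr (hl _ h)
    · exact Or.inl h
  · exact Or.inr (hy.2 hab ha)

/-- Induction on configurations, adding events one at a time. -/
theorem conf_induction {S : ESP} {P : Set S.E → Prop} (h0 : P ∅)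
    (h1 : ∀ x s, S.IsConf x → s ∉ x → S.IsConf (insert s x) → P x → P (insert s x))
    {x : Set S.E} (hx : S.IsConf x) : P x := by
  obtain ⟨n, hn⟩ : ∃ n, x.ncard = n := ⟨_, rfl⟩
  induction n generalizing x with
  | zero =>
    rw [(Set.ncard_eq_zero hx.finite).1 hn]
    exact h0
  | succ n ih =>
    have hne : x.Nonempty := by
      rw [← Set.ncard_pos hx.finite]
      omega
    -- Removing a maximal event leaves a down-closed set.
    obtain ⟨s, hs⟩ := hx.finite.exists_maximal hne
    have hc : S.IsConf (x \ {s}) := by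
      refine isConf_of_subset hx Set.sdiff_subset ?_
      rintro a b hab ⟨ha, has⟩
      refine ⟨hx.2 hab ha, ?_⟩
      rintro rfl
      exact has (le_antisymm (hs.2 ha hab) hab)
    have e : insert s (x \ {s}) = x := Set.insert_sdiff_self_of_mem hs.1
    have := h1 _ s hc (by simp) (e.symm ▸ hx) (ih hc (by
      rw [Set.ncard_sdiff_singleton_of_mem hs.1]
      omega))
    rwa [e] at this

variable {S : ESP} {F : Set (SetRel S.E S.E)} {θ χ : SetRel S.E S.E} {x y z : S.Conf}

theorem Via.mono {G : Set (SetRel S.E S.E)} (h : Via F θ x y) (hG : F ⊆ G) : Via G θ x y :=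
  ⟨hG h.1, h.2⟩

end ESP

namespace IsIsoFamily

open ESP

variable {S : ESP} {F : Set (SetRel S.E S.E)} {θ χ : SetRel S.E S.E} {x y z : S.Conf}

theorem via_inv (hF : IsIsoFamily S F) (h : Via F θ x y) : Via F θ.inv y x :=
  ⟨hF.inv_mem _ h.1, h.2.2, h.2.1⟩

theorem via_comp (hF : IsIsoFamily S F) (h : Via F θ x y) (h' : Via F χ y z) :
    Via F (θ ○ χ) x z :=
  have e : θ.cod = χ.dom := h.2.2.trans h'.2.1.symm
  ⟨hF.comp_mem _ h.1 _ h'.1 e, (SetRel.dom_comp_of_cod_subset e.le).trans h.2.1,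
    (SetRel.cod_comp_of_dom_subset e.ge).trans h'.2.2⟩

theorem cancel_left (hF : IsIsoFamily S F) (h : θ ∈ F) (hd : χ.dom ⊆ θ.dom) :
    θ ○ (θ.inv ○ χ) = χ := SetRel.comp_inv_comp_cancel (hF.injective _ h) hd

theorem cancel_left' (hF : IsIsoFamily S F) (h : θ ∈ F) (hd : χ.dom ⊆ θ.cod) :
    θ.inv ○ (θ ○ χ) = χ := hF.cancel_left (hF.inv_mem _ h) hd

theorem cancel_right (hF : IsIsoFamily S F) (h : θ ∈ F) (hd : χ.cod ⊆ θ.dom) :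
    (χ ○ θ) ○ θ.inv = χ := SetRel.comp_comp_inv_cancel (hF.injective _ h) hd

theorem cancel_right' (hF : IsIsoFamily S F) (h : θ ∈ F) (hd : χ.cod ⊆ θ.cod) :
    (χ ○ θ.inv) ○ θ = χ := hF.cancel_right (hF.inv_mem _ h) hd

theorem fst_eq (hF : IsIsoFamily S F) (h : θ ∈ F) {a a' b : S.E} (h1 : (a, b) ∈ θ)
    (h2 : (a', b) ∈ θ) : a = a' := congrArg Prod.fst (hF.injective _ h _ h1 _ h2 rfl)

theorem snd_eq (hF : IsIsoFamily S F) (h : θ ∈ F) {a b b' : S.E} (h1 : (a, b) ∈ θ)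
    (h2 : (a, b') ∈ θ) : b = b' := congrArg Prod.snd (hF.functional _ h _ h1 _ h2 rfl)

/-- The members of an isomorphism family extend by any event which is enabled in their source. -/
theorem extend_one (hF : IsIsoFamily S F) (h : θ ∈ F) {a : S.E} (ha : a ∉ θ.dom)
    (hc : S.IsConf (insert a θ.dom)) : ∃ a', insert (a, a') θ ∈ F := by
  obtain ⟨θ', h', hs, hd⟩ := hF.extend _ h _ hc (Set.subset_insert _ _)
  obtain ⟨a', ha'⟩ : a ∈ θ'.dom := hd ▸ Set.mem_insert _ _
  refine ⟨a', ?_⟩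
  -- The extension has only `a` as additional source, so functionality leaves no pair other than
  -- `(a, a')` to add.
  convert h' using 1
  refine Set.Subset.antisymm (Set.insert_subset ha' hs) ?_
  rintro ⟨b, c⟩ hbc
  have : b ∈ insert a θ.dom := hd ▸ ⟨c, hbc⟩
  rcases this with rfl | ⟨c', hc'⟩
  · rw [hF.snd_eq h' hbc ha']
    exact Or.inl rfl
  · rw [hF.snd_eq h' hbc (hs hc')]
    exact Or.inr hc'

/-- The members of an isomorphism family reflect the causal order. -/
theorem le_of_le (hF : IsIsoFamily S F) (h : θ ∈ F) {a b a' b' : S.E} (ha : (a, a') ∈ θ)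
    (hb : (b, b') ∈ θ) (hle : a' ≤ b') : a ≤ b := by
  have hc : S.IsConf (Set.Iic b) := isConf_of_subset (hF.conf_dom _ h)
    ((hF.conf_dom _ h).subset_Iic ⟨_, hb⟩) (isLowerSet_Iic b)
  -- The target of the restriction to the causes of `b` is down-closed and contains `b'`, hence
  -- `a'`; so `a` is among these causes.
  have hr := hF.restrict _ h _ hc ((hF.conf_dom _ h).subset_Iic ⟨_, hb⟩)
  obtain ⟨a₁, ha₁, hle'⟩ := (hF.conf_cod _ hr).2 hle ⟨b, hb, le_refl b⟩
  rwa [hF.fst_eq h ha ha₁]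

/-- The members of an isomorphism family preserve the strict causal order. -/
theorem lt_of_lt (hF : IsIsoFamily S F) (h : θ ∈ F) {a b a' b' : S.E} (ha : (a, a') ∈ θ)
    (hb : (b, b') ∈ θ) (hlt : a < b) : a' < b' := by
  refine lt_of_le_of_ne (hF.le_of_le (hF.inv_mem _ h) ha hb hlt.le) ?_
  rintro rfl
  exact hlt.ne (hF.fst_eq h ha hb)

/-- A symmetry which fixes the strict causes of an event restricts to the identity on these causes,
extended by the pair of that event and its image. -/
theorem restrict_Iic (hF : IsIsoFamily S F) (h : θ ∈ F) {a a' : S.E} (ha : (a, a') ∈ θ)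
    (hfix : ∀ b < a, ∀ b', (b, b') ∈ θ → b = b') :
    insert (a, a') (idGraph (Set.Iio a)) ∈ F := by
  have hc : S.IsConf (Set.Iic a) := isConf_of_subset (hF.conf_dom _ h)
    ((hF.conf_dom _ h).subset_Iic ⟨_, ha⟩) (isLowerSet_Iic a)
  convert hF.restrict _ h _ hc ((hF.conf_dom _ h).subset_Iic ⟨_, ha⟩) using 1
  ext ⟨b, c⟩
  constructor
  · rintro (h' | ⟨hb : b < a, rfl : b = c⟩)
    · cases h'
      exact ⟨ha, le_refl a⟩
    · obtain ⟨b', hb'⟩ := (hF.conf_dom _ h).2 hb.le ⟨_, ha⟩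
      obtain rfl := hfix _ hb _ hb'
      exact ⟨hb', hb.le⟩
  · rintro ⟨hbc, hb : b ≤ a⟩
    rcases hb.lt_or_eq with hb | rfl
    · exact Or.inr ⟨hb, hfix _ hb _ hbc⟩
    · rw [hF.snd_eq h hbc ha]
      exact Or.inl rfl

/-- Symmetric configurations are simultaneously `+`-covered. -/
theorem pCovered_of_via (hF : IsIsoFamily S F) (hp : ∀ θ ∈ F, ∀ p ∈ θ, S.pol p.1 = S.pol p.2)
    (h : Via F θ x y) (hx : S.PCovered x) : S.PCovered y := by
  intro s hs
  obtain ⟨r, hr⟩ : s ∈ θ.cod := h.2.2 ▸ hs.1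
  rw [← hp _ h.1 _ hr]
  refine hx r ⟨h.2.1 ▸ ⟨s, hr⟩, fun r' hr' hle => ?_⟩
  obtain ⟨s', hs'⟩ : r' ∈ θ.dom := h.2.1 ▸ hr'
  have := hF.le_of_le (hF.inv_mem _ h.1) hr hs' hle
  exact hF.le_of_le h.1 hs' hr (hs.2 (h.2.2 ▸ ⟨r', hs'⟩) this)

end IsIsoFamily

theorem ESP.isConf_Iio {S : ESP} {x : Set S.E} (h : S.IsConf x) {s : S.E} (hs : s ∈ x) :
    S.IsConf (Set.Iio s) :=
  ESP.isConf_of_subset h (fun _ hr => h.2 (le_of_lt hr) hs) (isLowerSet_Iio s)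

theorem ESP.isConf_Iic {S : ESP} {x : Set S.E} (h : S.IsConf x) {s : S.E} (hs : s ∈ x) :
    S.IsConf (Set.Iic s) :=
  ESP.isConf_of_subset h (h.subset_Iic hs) (isLowerSet_Iic s)

/-- In a positive symmetry, a negative event whose strict causes are fixed is fixed. -/
theorem TCG.fixed_of_symP (G : TCG) {θ : SetRel G.E G.E} (h : θ ∈ G.symP) {a a' : G.E}
    (ha : (a, a') ∈ θ) (hpol : G.pol a = .neg) (hfix : ∀ b < a, ∀ b', (b, b') ∈ θ → b = b') :
    a = a' := by
  have hP := G.symP_family.restrict_Iic h ha hfix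
  -- The same restriction extends an identity by a pair of negative events, so it is also negative;
  -- only identities are both.
  have hN : insert (a, a') (idGraph (Set.Iio a)) ∈ G.symN := by
    refine G.symN_ext _ (G.symN_family.id_mem _ (ESP.isConf_Iio (G.symP_family.conf_dom _ h)
      ⟨_, ha⟩)) _ (G.symP_subset hP) (Set.subset_insert _ _) ?_
    rintro p ⟨rfl | hp, hp'⟩
    · exact hpol
    · exact absurd hp hp'
  exact G.inter_id _ hP hN _ (Set.mem_insert _ _)

/-! ### Families on parallel compositions -/

section

variable {α β : Type*} {F : Set (SetRel α α)} {G : Set (SetRel β β)}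
  {θ χ : SetRel (α ⊕ β) (α ⊕ β)}

theorem relFst_sum (θ : SetRel α α) (χ : SetRel β β) : relFst (θ.sum χ) = θ := by
  ext ⟨a, b⟩; simp [relFst]

theorem relSnd_sum (θ : SetRel α α) (χ : SetRel β β) : relSnd (θ.sum χ) = χ := by
  ext ⟨a, b⟩; simp [relSnd]

theorem sum_mem_parFamily {θ : SetRel α α} {χ : SetRel β β} (h : θ ∈ F) (h' : χ ∈ G) :
    θ.sum χ ∈ parFamily F G := by
  refine ⟨?_, (relFst_sum θ χ).symm ▸ h, (relSnd_sum θ χ).symm ▸ h'⟩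
  rintro ⟨a | a, b | b⟩ hp <;> simp_all

theorem relFst_comp (h : ∀ p ∈ θ, p.1.isLeft = p.2.isLeft) :
    relFst (θ ○ χ) = relFst θ ○ relFst χ := by
  ext ⟨a, c⟩
  constructor
  · rintro ⟨b | b, hb, hc⟩
    · exact ⟨b, hb, hc⟩
    · simpa using h _ hb
  · rintro ⟨b, hb, hc⟩
    exact ⟨_, hb, hc⟩

theorem relSnd_comp (h : ∀ p ∈ θ, p.1.isLeft = p.2.isLeft) :
    relSnd (θ ○ χ) = relSnd θ ○ relSnd χ := by
  ext ⟨a, c⟩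
  constructor
  · rintro ⟨b | b, hb, hc⟩
    · simpa using h _ hb
    · exact ⟨b, hb, hc⟩
  · rintro ⟨b, hb, hc⟩
    exact ⟨_, hb, hc⟩

theorem relFst_insert_inl (a a' : α) :
    relFst (insert (Sum.inl a, Sum.inl a') θ) = insert (a, a') (relFst θ) := by
  ext ⟨b, c⟩; simp [relFst]

theorem relSnd_insert_inl (a a' : α) :
    relSnd (insert (Sum.inl a, Sum.inl a') θ) = relSnd θ := by
  ext ⟨b, c⟩; simp [relSnd]

theorem relFst_insert_inr (a a' : β) :
    relFst (insert (Sum.inr a, Sum.inr a') θ) = relFst θ := by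
  ext ⟨b, c⟩; simp [relFst]

theorem relSnd_insert_inr (a a' : β) :
    relSnd (insert (Sum.inr a, Sum.inr a') θ) = insert (a, a') (relSnd θ) := by
  ext ⟨b, c⟩; simp [relSnd]

end

/-! ### Strategies -/

namespace Strategy

open ESP

section

variable {G : TCG} (σ : Strategy G) {θ χ : SetRel σ.S.E σ.S.E} {x y : Set σ.S.E}

theorem mem_imageSym {s s' : σ.S.E} (h : (s, s') ∈ θ) : (σ.map s, σ.map s') ∈ σ.imageSym θ :=
  ⟨_, h, rfl⟩

theorem mem_imageSym_iff {g g' : G.E} :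
    (g, g') ∈ σ.imageSym θ ↔ ∃ s s', (s, s') ∈ θ ∧ σ.map s = g ∧ σ.map s' = g' := by
  simp [imageSym]

theorem dom_imageSym : (σ.imageSym θ).dom = σ.map '' θ.dom := by
  ext g
  constructor
  · rintro ⟨g', ⟨s, s'⟩, h, e⟩
    exact ⟨s, ⟨s', h⟩, congrArg Prod.fst e⟩
  · rintro ⟨s, ⟨s', h⟩, rfl⟩
    exact ⟨_, σ.mem_imageSym h⟩

theorem imageSym_inv : σ.imageSym θ.inv = (σ.imageSym θ).inv := by
  ext ⟨g, g'⟩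
  constructor
  · rintro ⟨⟨s, s'⟩, h, e⟩
    exact ⟨(s', s), h, by simpa [Prod.ext_iff, and_comm] using e⟩
  · rintro ⟨⟨s, s'⟩, h, e⟩
    exact ⟨(s', s), h, by simpa [Prod.ext_iff, and_comm] using e⟩

theorem cod_imageSym : (σ.imageSym θ).cod = σ.map '' θ.cod := by
  rw [← SetRel.dom_inv, ← imageSym_inv, dom_imageSym, SetRel.dom_inv]

theorem imageSym_insert (s s' : σ.S.E) :
    σ.imageSym (insert (s, s') θ) = insert (σ.map s, σ.map s') (σ.imageSym θ) :=
  Set.image_insert_eq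

/-- The events of the image of a symmetry are matched as those of the symmetry. -/
theorem exists_of_mem_imageSym (hx : σ.S.IsConf x) (hd : θ.dom ⊆ x) {s : σ.S.E} (hs : s ∈ x)
    {g' : G.E} (h : (σ.map s, g') ∈ σ.imageSym θ) : ∃ s', (s, s') ∈ θ ∧ σ.map s' = g' := by
  obtain ⟨r, r', hr, e, e'⟩ := σ.mem_imageSym_iff.1 h
  obtain rfl := σ.map_injOn _ hx (hd ⟨_, hr⟩) hs e
  exact ⟨r', hr, e'⟩

theorem imageSym_comp (hθ : σ.S.IsConf θ.cod) (h : χ.dom ⊆ θ.cod) :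
    σ.imageSym (θ ○ χ) = σ.imageSym θ ○ σ.imageSym χ := by
  ext ⟨g, g'⟩
  constructor
  · rintro ⟨⟨s, s'⟩, ⟨r, hr, hr'⟩, e⟩
    cases e
    exact ⟨σ.map r, σ.mem_imageSym hr, σ.mem_imageSym hr'⟩
  · rintro ⟨m, ⟨⟨s, r⟩, hr, e⟩, hm⟩
    cases e
    obtain ⟨s', hs', rfl⟩ := σ.exists_of_mem_imageSym hθ h ⟨_, hr⟩ hm
    exact σ.mem_imageSym ⟨r, hr, hs'⟩

theorem via_image {x y : σ.S.Conf} (h : Via σ.S.sym θ x y) :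
    Via G.sym (σ.imageSym θ) (σ.image x) (σ.image y) :=
  ⟨σ.map_sym _ h.1, by rw [dom_imageSym, h.2.1]; rfl, by rw [cod_imageSym, h.2.2]; rfl⟩

/-- Strategies reflect causality between the events of a configuration. -/
theorem exists_lt_of_lt_map (hx : σ.S.IsConf x) {s : σ.S.E} (hs : s ∈ x) {g : G.E}
    (h : g < σ.map s) : ∃ r < s, σ.map r = g := by
  obtain ⟨r, hr : r ≤ s, e⟩ := (σ.map_conf _ (isConf_Iic hx hs)).2 h.le ⟨s, le_refl s, rfl⟩
  refine ⟨r, lt_of_le_of_ne hr ?_, e⟩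
  rintro rfl
  exact h.ne' e

theorem lt_of_map_lt (hx : σ.S.IsConf x) {r s : σ.S.E} (hr : r ∈ x) (hs : s ∈ x)
    (h : σ.map r < σ.map s) : r < s := by
  obtain ⟨r', hr', e⟩ := σ.exists_lt_of_lt_map hx hs h
  rwa [← σ.map_injOn _ hx (hx.2 hr'.le hs) hr e]

theorem map_notMem_image (hc : σ.S.IsConf (insert s x)) (hs : s ∉ x) : σ.map s ∉ σ.map '' x := by
  rintro ⟨r, hr, e⟩
  exact hs (σ.map_injOn _ hc (Or.inr hr) (Or.inl rfl) e ▸ hr)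

/-- A symmetry of a strategy extends by a negative event as its image does. -/
theorem extend_neg (h : θ ∈ σ.S.sym) {s : σ.S.E} (hs : s ∉ θ.dom)
    (hc : σ.S.IsConf (insert s θ.dom)) (hpol : σ.S.pol s = .neg) {g' : G.E}
    (hg : insert (σ.map s, g') (σ.imageSym θ) ∈ G.sym) :
    ∃ s', σ.map s' = g' ∧ insert (s, s') θ ∈ σ.S.sym := by
  have hn := σ.map_notMem_image hc hs
  have hp : (σ.map s, g') ∉ Prod.map σ.map σ.map '' θ := fun hm =>
    hn (σ.dom_imageSym ▸ ⟨g', hm⟩)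
  have hpol' : G.pol (σ.map s) = .neg := (σ.map_pol s).trans hpol
  obtain ⟨⟨r, s'⟩, ⟨e, hq⟩, -⟩ := σ.sim_receptive _ h _ hp hpol' hg
  have hcr : σ.S.IsConf (insert r θ.dom) := by
    rw [← SetRel.dom_insert_pair r s']
    exact σ.S.sym_family.conf_dom _ hq
  have hcs := σ.map_conf _ hc
  rw [Set.image_insert_eq] at hcs
  -- ∼-receptivity only provides some `r` above `σ.map s`; receptivity at `θ.dom` identifies it with
  -- `s`.
  obtain rfl : r = s := (σ.receptive _ (σ.S.sym_family.conf_dom _ h) _ hn hpol' hcs).unique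
    ⟨congrArg Prod.fst e, hcr⟩ ⟨rfl, hc⟩
  exact ⟨s', congrArg Prod.snd e, hq⟩

/-- A symmetry of a strategy whose image is in some isomorphism family extends so that its image
stays there, provided that the family absorbs the extensions when the new event is positive. -/
theorem extend_family {F : Set (SetRel G.E G.E)} (hF : IsIsoFamily G.toESP F) (hs : F ⊆ G.sym)
    (h : θ ∈ σ.S.sym) (hi : σ.imageSym θ ∈ F) {s : σ.S.E} (hsd : s ∉ θ.dom)
    (hc : σ.S.IsConf (insert s θ.dom))
    (habs : σ.S.pol s = .pos → ∀ g', insert (σ.map s, g') (σ.imageSym θ) ∈ G.sym →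
      insert (σ.map s, g') (σ.imageSym θ) ∈ F) :
    ∃ s', insert (s, s') θ ∈ σ.S.sym ∧ σ.imageSym (insert (s, s') θ) ∈ F := by
  -- For positive `s` the strategy extends first and `F` absorbs the image; for negative `s` the
  -- image is extended inside `F` first and then lifted.
  rcases (σ.S.pol s).eq_pos_or_neg with hp | hp
  · obtain ⟨s', hs'⟩ := σ.S.sym_family.extend_one h hsd hc
    refine ⟨s', hs', ?_⟩
    have := σ.map_sym _ hs'
    rw [Set.image_insert_eq] at this
    rw [imageSym_insert]
    exact habs hp _ this
  · have hcs := σ.map_conf _ hc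
    rw [Set.image_insert_eq, ← dom_imageSym] at hcs
    obtain ⟨g', hg'⟩ := hF.extend_one hi
      (by rw [dom_imageSym]; exact σ.map_notMem_image hc hsd) hcs
    obtain ⟨s', rfl, h'⟩ := σ.extend_neg h hsd hc hp (hs hg')
    exact ⟨s', h', by rwa [imageSym_insert]⟩

/-- In a symmetry of a strategy, a positive event whose strict causes are fixed is fixed. -/
theorem fixed_of_pos (h : θ ∈ σ.S.sym) {s s' : σ.S.E} (hs : (s, s') ∈ θ)
    (hpol : σ.S.pol s = .pos) (hfix : ∀ r < s, ∀ r', (r, r') ∈ θ → r = r') : s = s' := by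
  have hc := σ.S.sym_family.conf_dom _ h
  have h1 := σ.S.sym_family.restrict_Iic h hs hfix
  have h2 := σ.S.sym_family.restrict_Iic
    (σ.S.sym_family.id_mem _ hc) (a := s) ⟨⟨_, hs⟩, rfl⟩ (fun r _ r' hr => hr.2)
  -- Both `(s, s)` and `(s, s')` extend the identity on the strict causes of `s`, and thinness
  -- allows one such extension.
  refine (σ.thin _ (σ.S.sym_family.id_mem _ (isConf_Iio hc ⟨_, hs⟩)) s ?_ hpol ?_).unique h2 h1
  · rw [idGraph_dom]; exact lt_irrefl s
  · rw [idGraph_dom, Set.Iio_insert]; exact isConf_Iic hc ⟨_, hs⟩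

/-- In a symmetry of a strategy, a negative event whose strict causes are fixed is fixed when its
image is. -/
theorem fixed_of_neg (h : θ ∈ σ.S.sym) {s s' : σ.S.E} (hs : (s, s') ∈ θ)
    (hpol : σ.S.pol s = .neg) (hfix : ∀ r < s, ∀ r', (r, r') ∈ θ → r = r')
    (hm : σ.map s = σ.map s') : s = s' := by
  have hc := σ.S.sym_family.conf_dom _ h
  have h1 := σ.S.sym_family.conf_cod _ (σ.S.sym_family.restrict_Iic h hs hfix)
  rw [SetRel.cod_insert_pair, idGraph_cod] at h1
  have h2 := isConf_Iic hc ⟨_, hs⟩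
  rw [← Set.Iio_insert] at h2
  have hcs := σ.map_conf _ h2
  rw [Set.image_insert_eq] at hcs
  -- Both `s` and `s'` are enabled after the strict causes of `s` and have the same negative image.
  exact (σ.receptive _ (isConf_Iio hc ⟨_, hs⟩) (σ.map s)
    (σ.map_notMem_image h2 (lt_irrefl s)) ((σ.map_pol s).trans hpol) hcs).unique
    ⟨rfl, h2⟩ ⟨hm.symm, h1⟩

/-- The symmetries of a strategy sent to positive symmetries are identities. -/
theorem eq_of_imageSym_symP (h : θ ∈ σ.S.sym) (hi : σ.imageSym θ ∈ G.symP) :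
    ∀ p ∈ θ, p.1 = p.2 := by
  have hc := σ.S.sym_family.conf_dom _ h
  suffices ∀ s ∈ θ.dom, ∀ s', (s, s') ∈ θ → s = s' from fun p hp => this p.1 ⟨p.2, hp⟩ p.2 hp
  intro s hs
  refine Set.WellFoundedOn.induction (P := fun s => ∀ s', (s, s') ∈ θ → s = s')
    (hc.finite.wellFoundedOn (r := (· < ·))) hs ?_
  rintro s hs ih s' hs'
  have hfix : ∀ r < s, ∀ r', (r, r') ∈ θ → r = r' := fun r hr r' hr' => ih r ⟨r', hr'⟩ hr r' hr'
  rcases (σ.S.pol s).eq_pos_or_neg with hp | hp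
  · exact σ.fixed_of_pos h hs' hp hfix
  -- The image is a negative event in a positive symmetry; its strict causes are images of strict
  -- causes of `s`, already fixed by induction.
  · refine σ.fixed_of_neg h hs' hp hfix (G.fixed_of_symP hi (σ.mem_imageSym hs')
      ((σ.map_pol s).trans hp) ?_)
    rintro g hg g' hgg'
    obtain ⟨r, hr, rfl⟩ := σ.exists_lt_of_lt_map hc hs hg
    obtain ⟨r', hr', rfl⟩ := σ.exists_of_mem_imageSym hc subset_rfl (hc.2 hr.le hs) hgg'
    rw [hfix _ hr _ hr']

/-- Every symmetry out of the image of a configuration factors as the image of a symmetry of the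
strategy followed by a positive symmetry. -/
theorem exists_factorization (hx : σ.S.IsConf x) :
    ∀ Θ ∈ G.sym, Θ.dom = σ.map '' x →
      ∃ θ ∈ σ.S.sym, θ.dom = x ∧ (σ.imageSym θ).inv ○ Θ ∈ G.symP := by
  -- `Θ` stays quantified in the motive because the induction hypothesis is used at its restriction
  -- to the smaller image.
  refine conf_induction (P := fun x => ∀ Θ ∈ G.sym, Θ.dom = σ.map '' x →
      ∃ θ ∈ σ.S.sym, θ.dom = x ∧ (σ.imageSym θ).inv ○ Θ ∈ G.symP) ?_ ?_ hx
  · intro Θ hΘ hd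
    have hcon : σ.S.IsConf ∅ := ⟨σ.S.con_empty, fun _ _ _ h => h⟩
    have hconG : G.IsConf ∅ := ⟨G.con_empty, fun _ _ _ h => h⟩
    refine ⟨idGraph ∅, σ.S.sym_family.id_mem _ hcon, idGraph_dom _, ?_⟩
    convert G.symP_family.id_mem _ hconG using 1
    ext ⟨g, g'⟩
    simp [imageSym, idGraph]
  · intro x s hx hs hc ih Θ hΘ hd
    have hsx := σ.map_notMem_image hc hs
    rw [Set.image_insert_eq] at hd
    have hr := G.sym_family.restrict _ hΘ _ (σ.map_conf _ hx) (hd ▸ Set.subset_insert _ _)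
    obtain ⟨g, hg⟩ : σ.map s ∈ Θ.dom := hd ▸ Set.mem_insert _ _
    set Θ' : SetRel G.E G.E := {p ∈ Θ | p.1 ∈ σ.map '' x} with hΘ'
    have hins : Θ = insert (σ.map s, g) Θ' := by
      ext ⟨a, b⟩
      constructor
      · intro hab
        have : a ∈ insert (σ.map s) (σ.map '' x) := hd ▸ ⟨b, hab⟩
        rcases this with rfl | h
        · rw [G.sym_family.snd_eq hΘ hab hg]
          exact Or.inl rfl
        · exact Or.inr ⟨hab, h⟩
      · rintro (h | h)
        · cases h
          exact hg
        · exact h.1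
    have hd' : Θ'.dom = σ.map '' x := by
      ext a
      constructor
      · rintro ⟨b, hb⟩
        exact hb.2
      · intro ha
        obtain ⟨b, hb⟩ : a ∈ Θ.dom := hd ▸ Set.mem_insert_of_mem _ ha
        exact ⟨b, hb, ha⟩
    obtain ⟨θ, hθ, rfl, hP⟩ := ih _ hr hd'
    have hdi := σ.dom_imageSym (θ := θ)
    have hg' : g ∉ Θ'.cod := by
      rintro ⟨a, ha⟩
      have := G.sym_family.fst_eq hΘ hg ha.1
      exact hsx (this ▸ ha.2)
    -- inserting a matched pair into both factors
    have key : ∀ s', insert (s, s') θ ∈ σ.S.sym →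
        (σ.imageSym (insert (s, s') θ)).inv ○ Θ =
          insert (σ.map s', g) ((σ.imageSym θ).inv ○ Θ') := by
      intro s' hs'
      rw [imageSym_insert, SetRel.inv_insert_pair, hins]
      ext ⟨a, b⟩
      constructor
      · rintro ⟨m, hm | hm, hm' | hm'⟩
        · cases hm; cases hm'
          exact Or.inl rfl
        · cases hm
          exact absurd hm'.2 hsx
        · cases hm'
          exact absurd (hdi ▸ ⟨a, hm⟩ : σ.map s ∈ σ.map '' θ.dom) hsx
        · exact Or.inr ⟨m, hm, hm'⟩
      · rintro (h | ⟨m, hm, hm'⟩)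
        · cases h
          exact ⟨σ.map s, Or.inl rfl, Or.inl rfl⟩
        · exact ⟨m, Or.inr hm, Or.inr hm'⟩
    rcases (σ.S.pol s).eq_pos_or_neg with hp | hp
    -- For positive `s` any extension of `θ` will do: the second factor grows by the pair `(σ.map
    -- s', g)` of positive events, which `symP` absorbs.
    · obtain ⟨s', hs'⟩ := σ.S.sym_family.extend_one hθ hs hc
      refine ⟨_, hs', SetRel.dom_insert_pair _ _ _, ?_⟩
      have hsym : (σ.imageSym (insert (s, s') θ)).inv ○ Θ ∈ G.sym := by
        refine G.sym_family.comp_mem _ (G.sym_family.inv_mem _ (σ.map_sym _ hs')) _ hΘ ?_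
        change (σ.imageSym (insert (s, s') θ)).dom = _
        rw [dom_imageSym, SetRel.dom_insert_pair, hd, Set.image_insert_eq]
      rw [key _ hs'] at hsym ⊢
      refine G.symP_ext _ hP _ hsym (Set.subset_insert _ _) ?_
      rintro p ⟨rfl | hp, hp'⟩
      · change G.pol (σ.map s') = .pos
        rw [σ.map_pol, ← σ.S.sym_pol _ hs' _ (Set.mem_insert _ _)]
        exact hp
      · exact absurd hp hp'
    · have hcodχ : ((σ.imageSym θ).inv ○ Θ').cod = Θ'.cod :=
        SetRel.cod_comp_of_dom_subset (by rw [hd', SetRel.cod_inv, hdi])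
      have hΘcod := G.sym_family.conf_cod _ hΘ
      rw [hins, SetRel.cod_insert_pair] at hΘcod
      -- For negative `s` the image of `s'` is dictated by the game: extend the inverse of the
      -- positive factor to `g`, inside `symP`. Composing `Θ` with it extends the image of `θ` by
      -- `(σ.map s, g')`, which ∼-receptivity lifts.
      obtain ⟨g', hg''⟩ := G.symP_family.extend_one (G.symP_family.inv_mem _ hP) (a := g)
        (by rw [SetRel.dom_inv, hcodχ]; exact hg') (by rw [SetRel.dom_inv, hcodχ]; exact hΘcod)
      have hcomp : insert (σ.map s, g') (σ.imageSym θ) =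
          Θ ○ insert (g, g') ((σ.imageSym θ).inv ○ Θ').inv := by
        have hi : σ.imageSym θ = Θ' ○ ((σ.imageSym θ).inv ○ Θ').inv := by
          rw [SetRel.inv_comp, SetRel.inv_inv]
          exact (G.sym_family.cancel_left hr (by rw [hdi, hd'])).symm
        rw [hins]
        ext ⟨a, b⟩
        constructor
        · rintro (h | h)
          · cases h
            exact ⟨g, Or.inl rfl, Or.inl rfl⟩
          · rw [hi] at h
            obtain ⟨m, hm, hm'⟩ := h
            exact ⟨m, Or.inr hm, Or.inr hm'⟩
        · rintro ⟨m, hm | hm, hm' | hm'⟩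
          · cases hm; cases hm'
            exact Or.inl rfl
          · cases hm
            exact absurd (hcodχ ▸ ⟨b, hm'⟩) hg'
          · cases hm'
            exact absurd ⟨a, hm⟩ hg'
          · refine Or.inr ?_
            rw [hi]
            exact ⟨m, hm, hm'⟩
      obtain ⟨s', rfl, hs'⟩ := σ.extend_neg hθ hs hc hp (g' := g') (by
        rw [hcomp]
        refine G.sym_family.comp_mem _ hΘ _ (G.symP_subset hg'') ?_
        rw [hins, SetRel.cod_insert_pair, SetRel.dom_insert_pair, SetRel.dom_inv, hcodχ])
      refine ⟨_, hs', SetRel.dom_insert_pair _ _ _, ?_⟩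
      rw [key _ hs']
      have := G.symP_family.inv_mem _ hg''
      rwa [SetRel.inv_insert_pair, SetRel.inv_inv] at this

end

end Strategy

namespace IsIsoFamily

/-- The domains need not agree: restricting `θ` to the domain of `χ` does not change the composite
and makes the two composable. -/
theorem inv_comp_mem {S : ESP} {F : Set (SetRel S.E S.E)} (hF : IsIsoFamily S F)
    {θ χ : SetRel S.E S.E} (hθ : θ ∈ F) (hχ : χ ∈ F) (hd : χ.dom ⊆ θ.dom) : θ.inv ○ χ ∈ F := by
  have hr := hF.restrict _ hθ _ (hF.conf_dom _ hχ) hd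
  have e : SetRel.dom {p ∈ θ | p.1 ∈ χ.dom} = χ.dom := by
    ext a
    constructor
    · rintro ⟨b, hb⟩
      exact hb.2
    · intro ha
      obtain ⟨b, hb⟩ := hd ha
      exact ⟨b, hb, ha⟩
  convert hF.comp_mem _ (hF.inv_mem _ hr) _ hχ e using 1
  ext ⟨a, c⟩
  constructor
  · rintro ⟨b, hb, hc⟩
    exact ⟨b, ⟨hb, ⟨c, hc⟩⟩, hc⟩
  · rintro ⟨b, hb, hc⟩
    exact ⟨b, hb.1, hc⟩

end IsIsoFamily

/-! ### Components of the symmetries of a strategy from `A` to `B` -/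

namespace Strategy

open ESP

variable {A B : TCG} (σ : Strategy (A.dual.par B)) {θ χ : SetRel σ.S.E σ.S.E} {x y : σ.S.Conf}

theorem mem_leftSym {a a' : A.E} : (a, a') ∈ σ.leftSym θ ↔
    ∃ s s', (s, s') ∈ θ ∧ σ.map s = Sum.inl a ∧ σ.map s' = Sum.inl a' :=
  σ.mem_imageSym_iff

theorem mem_rightSym {b b' : B.E} : (b, b') ∈ σ.rightSym θ ↔
    ∃ s s', (s, s') ∈ θ ∧ σ.map s = Sum.inr b ∧ σ.map s' = Sum.inr b' :=
  σ.mem_imageSym_iff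

theorem imageSym_isLeft (h : θ ∈ σ.S.sym) : ∀ p ∈ σ.imageSym θ, p.1.isLeft = p.2.isLeft :=
  (σ.map_sym _ h).1

theorem leftSym_mem (h : θ ∈ σ.S.sym) : σ.leftSym θ ∈ A.sym := (σ.map_sym _ h).2.1

theorem rightSym_mem (h : θ ∈ σ.S.sym) : σ.rightSym θ ∈ B.sym := (σ.map_sym _ h).2.2

theorem via_left (h : Via σ.S.sym θ x y) : Via A.sym (σ.leftSym θ) (σ.left x) (σ.left y) :=
  ⟨σ.leftSym_mem h.1, (relFst_dom (σ.imageSym_isLeft h.1)).trans (by rw [(σ.via_image h).2.1]; rfl),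
    (relFst_cod (σ.imageSym_isLeft h.1)).trans (by rw [(σ.via_image h).2.2]; rfl)⟩

theorem via_right (h : Via σ.S.sym θ x y) : Via B.sym (σ.rightSym θ) (σ.right x) (σ.right y) :=
  ⟨σ.rightSym_mem h.1,
    (relSnd_dom (σ.imageSym_isLeft h.1)).trans (by rw [(σ.via_image h).2.1]; rfl),
    (relSnd_cod (σ.imageSym_isLeft h.1)).trans (by rw [(σ.via_image h).2.2]; rfl)⟩

theorem leftSym_inv : σ.leftSym θ.inv = (σ.leftSym θ).inv := by
  rw [leftSym, imageSym_inv]; rfl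

theorem rightSym_inv : σ.rightSym θ.inv = (σ.rightSym θ).inv := by
  rw [rightSym, imageSym_inv]; rfl

theorem leftSym_comp (hθ : θ ∈ σ.S.sym) (h : χ.dom ⊆ θ.cod) :
    σ.leftSym (θ ○ χ) = σ.leftSym θ ○ σ.leftSym χ := by
  rw [leftSym, imageSym_comp σ (σ.S.sym_family.conf_cod _ hθ) h]
  exact relFst_comp (σ.imageSym_isLeft hθ)

theorem rightSym_comp (hθ : θ ∈ σ.S.sym) (h : χ.dom ⊆ θ.cod) :
    σ.rightSym (θ ○ χ) = σ.rightSym θ ○ σ.rightSym χ := by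
  rw [rightSym, imageSym_comp σ (σ.S.sym_family.conf_cod _ hθ) h]
  exact relSnd_comp (σ.imageSym_isLeft hθ)

theorem exists_map_inl (h : θ ∈ σ.S.sym) {s s' : σ.S.E} (hs : (s, s') ∈ θ) {a : A.E}
    (ha : σ.map s = Sum.inl a) : ∃ a', σ.map s' = Sum.inl a' := by
  have := σ.imageSym_isLeft h _ (σ.mem_imageSym hs)
  rw [ha] at this
  exact Sum.isLeft_iff.1 this.symm

theorem exists_map_inr (h : θ ∈ σ.S.sym) {s s' : σ.S.E} (hs : (s, s') ∈ θ) {b : B.E}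
    (hb : σ.map s = Sum.inr b) : ∃ b', σ.map s' = Sum.inr b' := by
  rcases hs' : σ.map s' with a | b'
  · obtain ⟨b', hb'⟩ := σ.exists_map_inl (σ.S.sym_family.inv_mem _ h) hs hs'
    simp [hb] at hb'
  · exact ⟨b', rfl⟩

theorem leftSym_insert_inl {s s' : σ.S.E} {a a' : A.E} (h : σ.map s = Sum.inl a)
    (h' : σ.map s' = Sum.inl a') :
    σ.leftSym (insert (s, s') θ) = insert (a, a') (σ.leftSym θ) := by
  rw [leftSym, imageSym_insert, h, h', relFst_insert_inl]; rfl

theorem rightSym_insert_inl {s s' : σ.S.E} {a a' : A.E} (h : σ.map s = Sum.inl a)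
    (h' : σ.map s' = Sum.inl a') : σ.rightSym (insert (s, s') θ) = σ.rightSym θ := by
  rw [rightSym, imageSym_insert, h, h', relSnd_insert_inl]; rfl

theorem leftSym_insert_inr {s s' : σ.S.E} {b b' : B.E} (h : σ.map s = Sum.inr b)
    (h' : σ.map s' = Sum.inr b') : σ.leftSym (insert (s, s') θ) = σ.leftSym θ := by
  rw [leftSym, imageSym_insert, h, h', relFst_insert_inr]; rfl

theorem rightSym_insert_inr {s s' : σ.S.E} {b b' : B.E} (h : σ.map s = Sum.inr b)
    (h' : σ.map s' = Sum.inr b') :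
    σ.rightSym (insert (s, s') θ) = insert (b, b') (σ.rightSym θ) := by
  rw [rightSym, imageSym_insert, h, h', relSnd_insert_inr]; rfl

theorem pol_inl {s : σ.S.E} {a : A.E} (h : σ.map s = Sum.inl a) :
    σ.S.pol s = (A.pol a).dual := by
  rw [← σ.map_pol, h]; rfl

theorem pol_inr {s : σ.S.E} {b : B.E} (h : σ.map s = Sum.inr b) : σ.S.pol s = B.pol b := by
  rw [← σ.map_pol, h]; rfl

theorem dom_leftSym_subset (hd : θ.dom ⊆ x.1) :
    (σ.leftSym θ).dom ⊆ (σ.left x).1 := by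
  rintro a ⟨a', ha⟩
  obtain ⟨s, s', hs, e, -⟩ := σ.mem_leftSym.1 ha
  exact ⟨s, hd ⟨_, hs⟩, e⟩

theorem dom_rightSym_subset (hd : θ.dom ⊆ x.1) :
    (σ.rightSym θ).dom ⊆ (σ.right x).1 := by
  rintro a ⟨a', ha⟩
  obtain ⟨s, s', hs, e, -⟩ := σ.mem_rightSym.1 ha
  exact ⟨s, hd ⟨_, hs⟩, e⟩

theorem lt_of_left_lt (x : σ.S.Conf) {r s : σ.S.E} (hr : r ∈ x.1) (hs : s ∈ x.1) {a a' : A.E}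
    (e : σ.map r = Sum.inl a) (e' : σ.map s = Sum.inl a') (h : a < a') : r < s :=
  σ.lt_of_map_lt x.2 hr hs (by rw [e, e']; exact Sum.inl_lt_inl_iff.2 h)

theorem lt_of_right_lt (x : σ.S.Conf) {r s : σ.S.E} (hr : r ∈ x.1) (hs : s ∈ x.1) {b b' : B.E}
    (e : σ.map r = Sum.inr b) (e' : σ.map s = Sum.inr b') (h : b < b') : r < s :=
  σ.lt_of_map_lt x.2 hr hs (by rw [e, e']; exact Sum.inr_lt_inr_iff.2 h)

end Strategy

/-! ### Secured bijections -/

section Secured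

variable {X Y X' Y' : Type*} [Preorder X] [Preorder Y] [Preorder X'] [Preorder Y']

/-- Acyclicity makes the transitive closure of the causal steps a strict order, which is
well-founded on a finite graph. -/
theorem Secured.induction {φ : SetRel X Y} (hφ : Secured φ) (hfin : φ.Finite) {P : X × Y → Prop}
    (h : ∀ p ∈ φ, (∀ q, CausalStep φ q p → P q) → P p) : ∀ p ∈ φ, P p := by
  intro p hp
  have : IsStrictOrder (X × Y) (Relation.TransGen (CausalStep φ)) :=
    { irrefl := hφ
      trans := fun _ _ _ => Relation.TransGen.trans }
  refine Set.WellFoundedOn.induction (P := P)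
    (hfin.wellFoundedOn (r := Relation.TransGen (CausalStep φ))) hp ?_
  intro p hp ih
  exact h p hp fun q hq => ih q hq.1 (.single hq)

theorem Secured.exists_minimal {φ : SetRel X Y} (hφ : Secured φ) (hfin : φ.Finite)
    {P : X × Y → Prop} (h : ∃ p ∈ φ, P p) : ∃ p ∈ φ, P p ∧ ∀ q, CausalStep φ q p → ¬ P q := by
  by_contra! hn
  obtain ⟨p, hp, hP⟩ := h
  refine hφ.induction hfin (P := fun p => ¬ P p) ?_ p hp hP
  intro q hq ih hPq
  obtain ⟨r, hr, hPr⟩ := hn q hq hPq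
  exact ih r hr hPr

/-- A bijection which is simulated by a secured one is secured. -/
theorem Secured.of_simulation {φ : SetRel X Y} {φ' : SetRel X' Y'} (hφ : Secured φ')
    (R : SetRel X X') (Q : SetRel Y Y')
    (hR : ∀ p ∈ R, ∀ q ∈ R, p.1 = q.1 → p = q) (hQ : ∀ p ∈ Q, ∀ q ∈ Q, p.1 = q.1 → p = q)
    (hRlt : ∀ p ∈ R, ∀ q ∈ R, p.1 < q.1 → p.2 < q.2)
    (hQlt : ∀ p ∈ Q, ∀ q ∈ Q, p.1 < q.1 → p.2 < q.2)
    (htot : ∀ p ∈ φ, ∃ p' ∈ φ', (p.1, p'.1) ∈ R ∧ (p.2, p'.2) ∈ Q) : Secured φ := by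
  intro p hp
  -- Causal chains are carried step by step along `R` and `Q`; as these are functional, a cycle is
  -- carried to a cycle.
  have key : ∀ p q, Relation.TransGen (CausalStep φ) p q → ∃ p' q',
      (p.1, p'.1) ∈ R ∧ (p.2, p'.2) ∈ Q ∧ (q.1, q'.1) ∈ R ∧ (q.2, q'.2) ∈ Q ∧
      Relation.TransGen (CausalStep φ') p' q' := by
    have step : ∀ p q, CausalStep φ p q → ∀ p' ∈ φ', (p.1, p'.1) ∈ R → (p.2, p'.2) ∈ Q →
        ∃ q' ∈ φ', (q.1, q'.1) ∈ R ∧ (q.2, q'.2) ∈ Q ∧ CausalStep φ' p' q' := by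
      rintro p q ⟨hp, hq, h⟩ p' hp' h1 h2
      obtain ⟨q', hq', h3, h4⟩ := htot q hq
      exact ⟨q', hq', h3, h4, hp', hq', h.imp (hRlt _ h1 _ h3) (hQlt _ h2 _ h4)⟩
    intro p q h
    have hpφ : p ∈ φ := by
      obtain ⟨r, hr, -⟩ := Relation.TransGen.head'_iff.1 h
      exact hr.1
    obtain ⟨p', hp', h1, h2⟩ := htot p hpφ
    suffices ∃ q' ∈ φ', (q.1, q'.1) ∈ R ∧ (q.2, q'.2) ∈ Q ∧
        Relation.TransGen (CausalStep φ') p' q' by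
      obtain ⟨q', -, h3, h4, h5⟩ := this
      exact ⟨p', q', h1, h2, h3, h4, h5⟩
    induction h with
    | single h =>
      obtain ⟨q', hq', h3, h4, h5⟩ := step _ _ h p' hp' h1 h2
      exact ⟨q', hq', h3, h4, .single h5⟩
    | tail _ h ih =>
      obtain ⟨r', hr', h3, h4, h5⟩ := ih
      obtain ⟨q', hq', h6, h7, h8⟩ := step _ _ h r' hr' h3 h4
      exact ⟨q', hq', h6, h7, h5.tail h8⟩
  obtain ⟨p', q', h1, h2, h3, h4, h⟩ := key p p hp
  have e1 : p'.1 = q'.1 := (Prod.ext_iff.1 (hR _ h1 _ h3 rfl)).2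
  have e2 : p'.2 = q'.2 := (Prod.ext_iff.1 (hQ _ h2 _ h4 rfl)).2
  have e : p' = q' := Prod.ext e1 e2
  exact hφ p' (e ▸ h)

end Secured

/-! ### Events of an interaction -/

section Interaction

open ESP

variable {A B C : TCG} {σ : Strategy (A.dual.par B)} {τ : Strategy (B.dual.par C)}
  {xS : σ.S.Conf} {xT : τ.S.Conf} {θ : SetRel B.E B.E}

theorem finite_syncGraph : (syncGraph σ τ xS xT θ).Finite := by
  refine (((xS.2.finite.image Sum.inl).union ((τ.right xT).2.finite.image Sum.inr)).prod
    (((σ.left xS).2.finite.image Sum.inl).union (xT.2.finite.image Sum.inr))).subset ?_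
  rintro p (⟨s, hs, a, ha, rfl⟩ | ⟨s, hs, t, ht, b, b', hb, -, hb', rfl⟩ | ⟨t, ht, c, hc, rfl⟩)
  · exact ⟨Or.inl ⟨s, hs, rfl⟩, Or.inl ⟨a, ⟨s, hs, ha⟩, rfl⟩⟩
  · exact ⟨Or.inl ⟨s, hs, rfl⟩, Or.inr ⟨t, ht, rfl⟩⟩
  · exact ⟨Or.inr ⟨c, ⟨t, ht, hc⟩, rfl⟩, Or.inr ⟨t, ht, rfl⟩⟩

/-- This turns causality inside `xS` into causality of the bijection: a cause of an event of `xS` is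
itself the source of some pair. Totality of `θ` supplies the partner of an event in `B`. -/
theorem exists_event_left (hθ : Via B.sym θ (σ.right xS) (τ.left xT)) {s : σ.S.E}
    (hs : s ∈ xS.1) : ∃ p ∈ syncGraph σ τ xS xT θ, p.1 = Sum.inl s := by
  rcases h : σ.map s with a | b
  · exact ⟨_, Or.inl ⟨s, hs, a, h, rfl⟩, rfl⟩
  · obtain ⟨b', hb'⟩ : b ∈ θ.dom := hθ.2.1 ▸ ⟨s, hs, h⟩
    obtain ⟨t, ht, e⟩ : b' ∈ (τ.left xT).1 := hθ.2.2 ▸ ⟨b, hb'⟩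
    exact ⟨_, Or.inr (Or.inl ⟨s, hs, t, ht, b, b', h, hb', e, rfl⟩), rfl⟩

theorem exists_event_right (hθ : Via B.sym θ (σ.right xS) (τ.left xT)) {t : τ.S.E}
    (ht : t ∈ xT.1) : ∃ p ∈ syncGraph σ τ xS xT θ, p.2 = Sum.inr t := by
  rcases h : τ.map t with b' | c
  · obtain ⟨b, hb⟩ : b' ∈ θ.cod := hθ.2.2 ▸ ⟨t, ht, h⟩
    obtain ⟨s, hs, e⟩ : b ∈ (σ.right xS).1 := hθ.2.1 ▸ ⟨b', hb⟩
    exact ⟨_, Or.inr (Or.inl ⟨s, hs, t, ht, b, b', e, hb, h, rfl⟩), rfl⟩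
  · exact ⟨_, Or.inr (Or.inr ⟨t, ht, c, h, rfl⟩), rfl⟩

/-- Securedness is invariant under symmetry. -/
theorem Secured.of_via {yS : σ.S.Conf} {yT : τ.S.Conf} {θ' : SetRel B.E B.E}
    {ω : SetRel σ.S.E σ.S.E} {ν : SetRel τ.S.E τ.S.E} (hω : Via σ.S.sym ω xS yS)
    (hν : Via τ.S.sym ν xT yT)
    (hθ : ∀ b b' c c', (b, b') ∈ θ → (b, c) ∈ σ.rightSym ω → (b', c') ∈ τ.leftSym ν →
      (c, c') ∈ θ')
    (h : Secured (syncGraph σ τ yS yT θ')) : Secured (syncGraph σ τ xS xT θ) := by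
  have hA := σ.leftSym_mem hω.1
  have hC := τ.rightSym_mem hν.1
  -- Sources, in `xS ∥ x_C`, move along `ω` and the `C`-part of `ν`; targets, in `x_A ∥ xT`, along
  -- the `A`-part of `ω` and `ν`.
  refine h.of_simulation (SetRel.sum ω (τ.rightSym ν)) (SetRel.sum (σ.leftSym ω) ν)
    ?_ ?_ ?_ ?_ ?_
  · rintro ⟨p | p, p' | p'⟩ hp ⟨q | q, q' | q'⟩ hq e <;> simp at hp hq e
    · obtain rfl := e
      rw [σ.S.sym_family.snd_eq hω.1 hp hq]
    · obtain rfl := e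
      rw [C.sym_family.snd_eq hC hp hq]
  · rintro ⟨p | p, p' | p'⟩ hp ⟨q | q, q' | q'⟩ hq e <;> simp at hp hq e
    · obtain rfl := e
      rw [A.sym_family.snd_eq hA hp hq]
    · obtain rfl := e
      rw [τ.S.sym_family.snd_eq hν.1 hp hq]
  · rintro ⟨p | p, p' | p'⟩ hp ⟨q | q, q' | q'⟩ hq e <;> simp at hp hq e ⊢
    · exact σ.S.sym_family.lt_of_lt hω.1 hp hq e
    · exact C.sym_family.lt_of_lt hC hp hq e
  · rintro ⟨p | p, p' | p'⟩ hp ⟨q | q, q' | q'⟩ hq e <;> simp at hp hq e ⊢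
    · exact A.sym_family.lt_of_lt hA hp hq e
    · exact τ.S.sym_family.lt_of_lt hν.1 hp hq e
  · rintro p (⟨s, hs, a, ha, rfl⟩ | ⟨s, hs, t, ht, b, b', hb, hbb, hb', rfl⟩ | ⟨t, ht, c, hc, rfl⟩)
    · obtain ⟨s', hs'⟩ : s ∈ ω.dom := hω.2.1 ▸ hs
      obtain ⟨a', ha'⟩ := σ.exists_map_inl hω.1 hs' ha
      exact ⟨_, Or.inl ⟨s', hω.2.2 ▸ ⟨s, hs'⟩, a', ha', rfl⟩, by simpa using hs',
        by simpa using σ.mem_leftSym.2 ⟨s, s', hs', ha, ha'⟩⟩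
    · obtain ⟨s', hs'⟩ : s ∈ ω.dom := hω.2.1 ▸ hs
      obtain ⟨t', ht'⟩ : t ∈ ν.dom := hν.2.1 ▸ ht
      obtain ⟨c, hc⟩ := σ.exists_map_inr hω.1 hs' hb
      obtain ⟨c', hc'⟩ := τ.exists_map_inl hν.1 ht' hb'
      exact ⟨_, Or.inr (Or.inl ⟨s', hω.2.2 ▸ ⟨s, hs'⟩, t', hν.2.2 ▸ ⟨t, ht'⟩, c, c', hc,
        hθ b b' c c' hbb (σ.mem_rightSym.2 ⟨s, s', hs', hb, hc⟩)
          (τ.mem_leftSym.2 ⟨t, t', ht', hb', hc'⟩), hc', rfl⟩), by simpa using hs',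
        by simpa using ht'⟩
    · obtain ⟨t', ht'⟩ : t ∈ ν.dom := hν.2.1 ▸ ht
      obtain ⟨c', hc'⟩ := τ.exists_map_inr hν.1 ht' hc
      exact ⟨_, Or.inr (Or.inr ⟨t', hν.2.2 ▸ ⟨t, ht'⟩, c', hc', rfl⟩),
        by simpa using τ.mem_rightSym.2 ⟨t, t', ht', hc, hc'⟩, by simpa using ht'⟩

end Interaction

section Interaction

open ESP

variable {A B C : TCG} {σ : Strategy (A.dual.par B)} {τ : Strategy (B.dual.par C)}

/-! ### Covered interactions -/

/-- Courtesy only concerns immediate causality, so a strict inequality has to be refined to a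
covering step; finiteness of causes makes this possible. -/
theorem ESP.exists_covBy {S : ESP} {s s' : S.E} (h : s < s') : ∃ r, s ⋖ r ∧ r ≤ s' := by
  have hfin : (Set.Ioc s s').Finite := (S.finite_causes s').subset fun _ h => h.2
  obtain ⟨r, hr⟩ := hfin.exists_minimal ⟨s', h, le_refl s'⟩
  refine ⟨r, ⟨hr.1.1, fun t hst htr => ?_⟩, hr.1.2⟩
  exact htr.not_ge (hr.2 ⟨hst, htr.le.trans hr.1.2⟩ htr.le)

namespace IntConf

theorem via_id (z : IntConf σ τ) :
    Via B.sym (idGraph (σ.right z.xS).1) (σ.right z.xS) (τ.left z.xT) :=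
  ⟨B.sym_family.id_mem _ (σ.right z.xS).2, idGraph_dom _, by rw [idGraph_cod, z.matching]⟩

/-- An interaction is `+`-covered exactly when both of its components are. -/
theorem pCovered_iff (z : IntConf σ τ) :
    z.PCovered ↔ σ.S.PCovered z.xS ∧ τ.S.PCovered z.xT := by
  constructor
  · intro hz
    constructor
    · intro s hs
      by_contra hpol
      have hneg := (σ.S.pol s).eq_pos_or_neg.resolve_left hpol
      rcases h : σ.map s with a | b
      · have hp : (Sum.inl s, Sum.inl a) ∈ z.events := Or.inl ⟨s, hs.1, a, h, rfl⟩
        have := hz _ hp ?_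
        · exact hpol ((σ.pol_inl h).trans this)
        · rintro q ⟨-, hq, hlt⟩
          rcases hq with ⟨s', hs', a', ha', rfl⟩ | ⟨s', hs', t', ht', b, b', hb, -, hb', rfl⟩ |
            ⟨t', ht', c, hc, rfl⟩
          · refine absurd hs' (hs.not_prop_of_gt ?_)
            rcases hlt with hlt | hlt
            · exact Sum.inl_lt_inl_iff.1 hlt
            · exact σ.lt_of_left_lt z.xS hs.1 hs' h ha' (Sum.inl_lt_inl_iff.1 hlt)
          · rcases hlt with hlt | hlt
            · exact hs.not_prop_of_gt (Sum.inl_lt_inl_iff.1 hlt) hs'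
            · simp at hlt
          · simp at hlt
      · obtain ⟨t, ht, e⟩ : b ∈ (τ.left z.xT).1 := z.matching ▸ ⟨s, hs.1, h⟩
        have hp : (Sum.inl s, Sum.inr t) ∈ z.events :=
          Or.inr (Or.inl ⟨s, hs.1, t, ht, b, b, h, ⟨⟨s, hs.1, h⟩, rfl⟩, e, rfl⟩)
        refine hz _ hp ?_
        -- The partner `t` is positive for `τ`, so by courtesy an immediate successor of `t` comes
        -- from one in the game. It cannot lie in `C`, and in `B` its partner would lie above the
        -- maximal `s`. Hence the synchronized event is maximal, although it is neutral.
        have htmax : ∀ t' ∈ z.xT.1, ¬ t < t' := by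
          intro t' ht' hlt
          obtain ⟨r, hr, hrt⟩ := exists_covBy hlt
          have hrz : r ∈ z.xT.1 := z.xT.2.2 hrt ht'
          have hpt : τ.S.pol t = .pos := by
            rw [τ.pol_inl e, ← σ.pol_inr h, hneg]; rfl
          have hcov := τ.courteous _ _ hr (Or.inl hpt)
          rcases e' : τ.map r with b' | c
          · rw [e, e'] at hcov
            have hlt' : b < b' := Sum.inl_lt_inl_iff.1 hcov.lt
            obtain ⟨s', hs', h'⟩ : b' ∈ (σ.right z.xS).1 := z.matching ▸ ⟨r, hrz, e'⟩
            exact hs.not_prop_of_gt (σ.lt_of_right_lt z.xS hs.1 hs' h h' hlt') hs'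
          · rw [e, e'] at hcov
            exact Sum.not_inl_lt_inr hcov.lt
        rintro q ⟨-, hq, hlt⟩
        rcases hq with ⟨s', hs', a', ha', rfl⟩ | ⟨s', hs', t', ht', b, b', hb, -, hb', rfl⟩ |
          ⟨t', ht', c, hc, rfl⟩
        · rcases hlt with hlt | hlt
          · exact hs.not_prop_of_gt (Sum.inl_lt_inl_iff.1 hlt) hs'
          · simp at hlt
        · rcases hlt with hlt | hlt
          · exact hs.not_prop_of_gt (Sum.inl_lt_inl_iff.1 hlt) hs'
          · exact htmax _ ht' (Sum.inr_lt_inr_iff.1 hlt)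
        · rcases hlt with hlt | hlt
          · simp at hlt
          · exact htmax _ ht' (Sum.inr_lt_inr_iff.1 hlt)
    · intro t ht
      by_contra hpol
      have hneg := (τ.S.pol t).eq_pos_or_neg.resolve_left hpol
      rcases h : τ.map t with b | c
      · obtain ⟨s, hs, e⟩ : b ∈ (σ.right z.xS).1 := z.matching ▸ ⟨t, ht.1, h⟩
        have hp : (Sum.inl s, Sum.inr t) ∈ z.events :=
          Or.inr (Or.inl ⟨s, hs, t, ht.1, b, b, e, ⟨⟨s, hs, e⟩, rfl⟩, h, rfl⟩)
        refine hz _ hp ?_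
        -- The mirror argument: `s` is positive for `σ`, and courtesy of `σ` excludes successors.
        have hsmax : ∀ s' ∈ z.xS.1, ¬ s < s' := by
          intro s' hs' hlt
          obtain ⟨r, hr, hrs⟩ := exists_covBy hlt
          have hrz : r ∈ z.xS.1 := z.xS.2.2 hrs hs'
          have hps : σ.S.pol s = .pos := by
            rw [τ.pol_inl h, ← σ.pol_inr e] at hneg
            revert hneg
            cases σ.S.pol s <;> simp [Polarity.dual]
          have hcov := σ.courteous _ _ hr (Or.inl hps)
          rcases e' : σ.map r with a | b'
          · rw [e, e'] at hcov
            exact Sum.not_inr_lt_inl hcov.lt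
          · rw [e, e'] at hcov
            have hlt' : b < b' := Sum.inr_lt_inr_iff.1 hcov.lt
            obtain ⟨t', ht', h'⟩ : b' ∈ (τ.left z.xT).1 := z.matching ▸ ⟨r, hrz, e'⟩
            exact ht.not_prop_of_gt (τ.lt_of_left_lt z.xT ht.1 ht' h h' hlt') ht'
        rintro q ⟨-, hq, hlt⟩
        rcases hq with ⟨s', hs', a', ha', rfl⟩ | ⟨s', hs', t', ht', b, b', hb, -, hb', rfl⟩ |
          ⟨t', ht', c, hc, rfl⟩
        · rcases hlt with hlt | hlt
          · exact hsmax _ hs' (Sum.inl_lt_inl_iff.1 hlt)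
          · simp at hlt
        · rcases hlt with hlt | hlt
          · exact hsmax _ hs' (Sum.inl_lt_inl_iff.1 hlt)
          · exact ht.not_prop_of_gt (Sum.inr_lt_inr_iff.1 hlt) ht'
        · rcases hlt with hlt | hlt
          · simp at hlt
          · exact ht.not_prop_of_gt (Sum.inr_lt_inr_iff.1 hlt) ht'
      · have hp : (Sum.inr c, Sum.inr t) ∈ z.events := Or.inr (Or.inr ⟨t, ht.1, c, h, rfl⟩)
        have := hz _ hp ?_
        · exact hpol ((τ.pol_inr h).trans this)
        · rintro q ⟨-, hq, hlt⟩
          rcases hq with ⟨s', hs', a', ha', rfl⟩ | ⟨s', hs', t', ht', b, b', hb, -, hb', rfl⟩ |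
            ⟨t', ht', c', hc, rfl⟩
          · simp at hlt
          · rcases hlt with hlt | hlt
            · simp at hlt
            · exact ht.not_prop_of_gt (Sum.inr_lt_inr_iff.1 hlt) ht'
          · refine absurd ht' (ht.not_prop_of_gt ?_)
            rcases hlt with hlt | hlt
            · exact τ.lt_of_right_lt z.xT ht.1 ht' h hc (Sum.inr_lt_inr_iff.1 hlt)
            · exact Sum.inr_lt_inr_iff.1 hlt
  · rintro ⟨hS, hT⟩ p hp hmax
    have maxS : ∀ s ∈ z.xS.1, p.1 = Sum.inl s → Maximal (· ∈ z.xS.1) s := by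
      intro s hs e
      refine ⟨hs, fun s' hs' hle => ?_⟩
      by_contra hn
      obtain ⟨q, hq, e'⟩ := exists_event_left z.via_id hs'
      exact hmax q ⟨hp, hq, Or.inl (by rw [e, e']; exact Sum.inl_lt_inl_iff.2 (lt_of_le_not_ge hle hn))⟩
    have maxT : ∀ t ∈ z.xT.1, p.2 = Sum.inr t → Maximal (· ∈ z.xT.1) t := by
      intro t ht e
      refine ⟨ht, fun t' ht' hle => ?_⟩
      by_contra hn
      obtain ⟨q, hq, e'⟩ := exists_event_right z.via_id ht'
      exact hmax q ⟨hp, hq, Or.inr (by rw [e, e']; exact Sum.inr_lt_inr_iff.2 (lt_of_le_not_ge hle hn))⟩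
    rcases hp with ⟨s, hs, a, ha, rfl⟩ | ⟨s, hs, t, ht, b, b', hb, hbb, hb', rfl⟩ |
      ⟨t, ht, c, hc, rfl⟩
    · exact (σ.pol_inl ha).symm.trans (hS s (maxS s hs rfl))
    · obtain rfl : b = b' := hbb.2
      -- A maximal synchronized event would be positive for both strategies, which see it with
      -- opposite polarities.
      have h1 := (σ.pol_inr hb).symm.trans (hS s (maxS s hs rfl))
      have h2 := (τ.pol_inl hb').symm.trans (hT t (maxT t ht rfl))
      rw [h1] at h2
      cases h2
    · exact (τ.pol_inr hc).symm.trans (hT t (maxT t ht rfl))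

/-! ### Rigidity -/

/-- A pair of symmetries which agree on `B`, are negative on `A` and positive on `C`, and whose
sources form an interaction, consists of identities. -/
theorem eq_of_sym (z : IntConf σ τ) {α : SetRel σ.S.E σ.S.E} {β : SetRel τ.S.E τ.S.E}
    (hα : α ∈ σ.S.sym) (hαd : α.dom = z.xS.1) (hβ : β ∈ τ.S.sym) (hβd : β.dom = z.xT.1)
    (hA : σ.leftSym α ∈ A.symN) (hC : τ.rightSym β ∈ C.symP)
    (hB : σ.rightSym α = τ.leftSym β) :
    (∀ p ∈ α, p.1 = p.2) ∧ ∀ p ∈ β, p.1 = p.2 := by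
  suffices H : ∀ p ∈ z.events, (∀ s, p.1 = Sum.inl s → ∀ s', (s, s') ∈ α → s = s') ∧
      ∀ t, p.2 = Sum.inr t → ∀ t', (t, t') ∈ β → t = t' by
    constructor
    · rintro ⟨s, s'⟩ hs
      obtain ⟨p, hp, e⟩ := exists_event_left z.via_id (s := s) (hαd ▸ ⟨_, hs⟩)
      exact (H p hp).1 s e s' hs
    · rintro ⟨t, t'⟩ ht
      obtain ⟨p, hp, e⟩ := exists_event_right z.via_id (t := t) (hβd ▸ ⟨_, ht⟩)
      exact (H p hp).2 t e t' ht
  refine z.compatible.induction finite_syncGraph ?_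
  intro p hp ih
  have fixS : ∀ s, p.1 = Sum.inl s → ∀ r < s, ∀ r', (r, r') ∈ α → r = r' := by
    intro s e r hr r' hr'
    obtain ⟨q, hq, e'⟩ := exists_event_left z.via_id (s := r) (hαd ▸ ⟨_, hr'⟩)
    exact (ih q ⟨hq, hp, Or.inl (by rw [e, e']; exact Sum.inl_lt_inl_iff.2 hr)⟩).1 r e' r' hr'
  have fixT : ∀ t, p.2 = Sum.inr t → ∀ r < t, ∀ r', (r, r') ∈ β → r = r' := by
    intro t e r hr r' hr'
    obtain ⟨q, hq, e'⟩ := exists_event_right z.via_id (t := r) (hβd ▸ ⟨_, hr'⟩)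
    exact (ih q ⟨hq, hp, Or.inr (by rw [e, e']; exact Sum.inr_lt_inr_iff.2 hr)⟩).2 r e' r' hr'
  rcases hp with ⟨s, hs, a, ha, rfl⟩ | ⟨s, hs, t, ht, b, b', hb, hbb, hb', rfl⟩ |
    ⟨t, ht, c, hc, rfl⟩
  · refine ⟨?_, fun t e => by simp at e⟩
    rintro _ ⟨⟩ s' hs'
    have hfix := fixS s rfl
    rcases (σ.S.pol s).eq_pos_or_neg with hpol | hpol
    · exact σ.fixed_of_pos hα hs' hpol hfix
    · obtain ⟨a', ha'⟩ := σ.exists_map_inl hα hs' ha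
      refine σ.fixed_of_neg hα hs' hpol hfix ?_
      rw [ha, ha']
      -- A negative symmetry of `A` is a positive one of the dual, where the image of `s` is a
      -- negative event.
      refine congrArg Sum.inl (A.dual.fixed_of_symP hA (σ.mem_leftSym.2 ⟨s, s', hs', ha, ha'⟩)
        ((σ.pol_inl ha).symm.trans hpol) ?_)
      intro g hg g' hgg'
      obtain ⟨r, r', hr, e, e'⟩ := σ.mem_leftSym.1 hgg'
      have hlt := σ.lt_of_left_lt z.xS (hαd ▸ ⟨_, hr⟩) hs e ha hg
      obtain rfl := hfix r hlt r' hr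
      exact Sum.inl_injective (e.symm.trans e')
  · obtain rfl : b = b' := hbb.2
    have hfixS := fixS s rfl
    have hfixT := fixT t rfl
    -- The strategy playing the event positively fixes it by thinness. Its image in `B` is then
    -- fixed, `hB` transfers this to the other strategy, and receptivity concludes there.
    rcases (σ.S.pol s).eq_pos_or_neg with hpol | hpol
    · have h1 : ∀ s', (s, s') ∈ α → s = s' := fun s' hs' => σ.fixed_of_pos hα hs' hpol hfixS
      refine ⟨fun _ e => by cases e; exact h1, ?_⟩
      rintro _ ⟨⟩ t' ht'
      obtain ⟨c, hc⟩ := τ.exists_map_inl hβ ht' hb'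
      have hbc : (b, c) ∈ σ.rightSym α := hB ▸ τ.mem_leftSym.2 ⟨t, t', ht', hb', hc⟩
      obtain ⟨r, r', hr, e, e'⟩ := σ.mem_rightSym.1 hbc
      obtain rfl : r = s := σ.map_injOn _ z.xS.2 (hαd ▸ ⟨_, hr⟩) hs (e.trans hb.symm)
      obtain rfl := h1 _ hr
      refine τ.fixed_of_neg hβ ht' ?_ hfixT ?_
      · rw [τ.pol_inl hb', ← σ.pol_inr hb, hpol]; rfl
      · rw [hb', hc, Sum.inr_injective (e.symm.trans e')]
    · have hpolT : τ.S.pol t = .pos := by rw [τ.pol_inl hb', ← σ.pol_inr hb, hpol]; rfl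
      have h1 : ∀ t', (t, t') ∈ β → t = t' := fun t' ht' => τ.fixed_of_pos hβ ht' hpolT hfixT
      refine ⟨?_, fun _ e => by cases e; exact h1⟩
      rintro _ ⟨⟩ s' hs'
      obtain ⟨c, hc⟩ := σ.exists_map_inr hα hs' hb
      have hbc : (b, c) ∈ τ.leftSym β := hB ▸ σ.mem_rightSym.2 ⟨s, s', hs', hb, hc⟩
      obtain ⟨r, r', hr, e, e'⟩ := τ.mem_leftSym.1 hbc
      obtain rfl : r = t := τ.map_injOn _ z.xT.2 (hβd ▸ ⟨_, hr⟩) ht (e.trans hb'.symm)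
      obtain rfl := h1 _ hr
      refine σ.fixed_of_neg hα hs' hpol hfixS ?_
      rw [hb, hc, Sum.inl_injective (e.symm.trans e')]
  · refine ⟨fun t e => by simp at e, ?_⟩
    rintro _ ⟨⟩ t' ht'
    have hfix := fixT t rfl
    rcases (τ.S.pol t).eq_pos_or_neg with hpol | hpol
    · exact τ.fixed_of_pos hβ ht' hpol hfix
    · obtain ⟨c', hc'⟩ := τ.exists_map_inr hβ ht' hc
      refine τ.fixed_of_neg hβ ht' hpol hfix ?_
      rw [hc, hc']
      refine congrArg Sum.inr (C.fixed_of_symP hC (τ.mem_rightSym.2 ⟨t, t', ht', hc, hc'⟩)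
        ((τ.pol_inr hc).symm.trans hpol) ?_)
      intro g hg g' hgg'
      obtain ⟨r, r', hr, e, e'⟩ := τ.mem_rightSym.1 hgg'
      have hlt := τ.lt_of_right_lt z.xT (hβd ▸ ⟨_, hr⟩) ht e hc hg
      obtain rfl := hfix r hlt r' hr
      exact Sum.inr_injective (e.symm.trans e')

end IntConf

end Interaction

/-! ### Interaction up to symmetry -/

theorem IsIsoFamily.empty_mem {S : ESP} {F : Set (SetRel S.E S.E)} (hF : IsIsoFamily S F) :
    (∅ : SetRel S.E S.E) ∈ F := by
  convert hF.id_mem ∅ ⟨S.con_empty, fun _ _ _ h => h⟩ using 1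
  ext p
  simp [idGraph]

/-- The relations `ρ` and `ρ'` correspond to each other along `θ`. -/
def Linked {α γ : Type*} (θ : SetRel α α) (ρ ρ' : SetRel α γ) : Prop :=
  ∀ a a', (a, a') ∈ θ → ∀ c, (a, c) ∈ ρ ↔ (a', c) ∈ ρ'

namespace Linked

open ESP

variable {S : ESP} {F : Set (SetRel S.E S.E)} {θ ρ ρ' : SetRel S.E S.E}

theorem symm (h : Linked θ ρ ρ') : Linked θ.inv ρ' ρ :=
  fun a a' ha c => (h a' a ha c).symm

theorem insert (hF : IsIsoFamily S F) (hθ : θ ∈ F) (h : Linked θ ρ ρ') {a a' c : S.E}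
    (ha : (a, a') ∈ θ) : Linked θ (insert (a, c) ρ) (insert (a', c) ρ') := by
  intro m m' hm d
  have : m = a ↔ m' = a' := by
    constructor
    · rintro rfl
      exact hF.snd_eq hθ hm ha
    · rintro rfl
      exact hF.fst_eq hθ hm ha
  simp only [Set.mem_insert_iff, Prod.mk.injEq, h m m' hm d, this]

theorem eq_comp (h : Linked θ ρ ρ') (hd : ρ.dom ⊆ θ.dom) : ρ = θ ○ ρ' := by
  ext ⟨a, c⟩
  constructor
  · intro hc
    obtain ⟨a', ha'⟩ := hd ⟨c, hc⟩
    exact ⟨a', ha', (h a a' ha' c).1 hc⟩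
  · rintro ⟨a', ha', hc⟩
    exact (h a a' ha' c).2 hc

/-- Extending one of two linked members of a family allows to extend the other one. -/
theorem insert_mem (hF : IsIsoFamily S F) (hθ : θ ∈ F) (h : Linked θ ρ ρ') {a a' c : S.E}
    (ha : (a, a') ∈ θ) (hd : ρ.dom ⊆ θ.dom) (hd' : ρ'.dom ⊆ θ.cod)
    (hm : Insert.insert (a, c) ρ ∈ F) : Insert.insert (a', c) ρ' ∈ F := by
  -- The extended `ρ'` is the extended `ρ` precomposed with the inverse of `θ`.
  have h' := (h.insert hF hθ ha (c := c)).symm.eq_comp (by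
    rw [SetRel.dom_insert_pair]
    exact Set.insert_subset ⟨a, ha⟩ hd')
  rw [h']
  refine hF.inv_comp_mem hθ hm ?_
  rw [SetRel.dom_insert_pair]
  exact Set.insert_subset ⟨a', ha⟩ hd

end Linked

section Interaction

open ESP

variable {A B C : TCG} {σ : Strategy (A.dual.par B)} {τ : Strategy (B.dual.par C)}

variable (σ τ) in
/-- Symmetries of `σ` and `τ`, negative on `A` and positive on `C`, from parts of `xS` and `xT`,
which correspond to each other on `B` along `θ`. -/
structure PartialLift (xS : σ.S.Conf) (xT : τ.S.Conf) (θ : SetRel B.E B.E)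
    (ω : SetRel σ.S.E σ.S.E) (ν : SetRel τ.S.E τ.S.E) : Prop where
  memS : ω ∈ σ.S.sym
  memT : ν ∈ τ.S.sym
  domS : ω.dom ⊆ xS.1
  domT : ν.dom ⊆ xT.1
  negA : σ.imageSym ω ∈ parFamily A.symN B.sym
  posC : τ.imageSym ν ∈ parFamily B.sym C.symP
  linked : Linked θ (σ.rightSym ω) (τ.leftSym ν)

/-! ### Extension of partial lifts along the causal order -/

namespace PartialLift

variable {xS : σ.S.Conf} {xT : τ.S.Conf} {θ : SetRel B.E B.E}
  {ω : SetRel σ.S.E σ.S.E} {ν : SetRel τ.S.E τ.S.E}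

theorem empty : PartialLift σ τ xS xT θ ∅ ∅ := by
  have eS : σ.imageSym ∅ = ∅ := Set.image_empty _
  have eT : τ.imageSym ∅ = ∅ := Set.image_empty _
  refine ⟨σ.S.sym_family.empty_mem, τ.S.sym_family.empty_mem, by simp, by simp, ?_, ?_, ?_⟩
  · rw [eS]
    exact (A.symN_family.par B.sym_family).empty_mem
  · rw [eT]
    exact (B.sym_family.par C.symP_family).empty_mem
  · intro b b' _ c
    rw [Strategy.rightSym, Strategy.leftSym, eS, eT]
    simp [relFst, relSnd]

/-- Extension by an event of `σ` in `A`. -/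
theorem extend_left (h : PartialLift σ τ xS xT θ ω ν) {s : σ.S.E} (hs : s ∈ xS.1)
    (hsd : s ∉ ω.dom) (hlow : ∀ r < s, r ∈ ω.dom) {a : A.E} (ha : σ.map s = Sum.inl a) :
    ∃ s', PartialLift σ τ xS xT θ (insert (s, s') ω) ν := by
  have hc := isConf_insert xS.2 (σ.S.sym_family.conf_dom _ h.memS) h.domS hs hlow
  obtain ⟨s', hs', hi⟩ := σ.extend_family (F := parFamily A.symN B.sym)
    (A.symN_family.dual.par B.sym_family)
    (fun _ h => ⟨h.1, A.symN_subset h.2.1, h.2.2⟩) h.memS h.negA hsd hc (by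
      rintro hp (a' | b) hg
      · refine ⟨hg.1, ?_, hg.2.2⟩
        have h1 := hg.2.1
        rw [ha, relFst_insert_inl] at h1 ⊢
        -- An event of `A` that `σ` plays positively is negative in `A`.
        refine A.symN_ext _ h.negA.2.1 _ h1 (Set.subset_insert _ _) ?_
        rintro p ⟨rfl | hq, hq'⟩
        · rw [σ.pol_inl ha] at hp
          revert hp
          change _ → A.pol a = .neg
          cases A.pol a <;> simp [Polarity.dual]
        · exact absurd hq hq'
      · have := hg.1 _ (Set.mem_insert _ _)
        simp [ha] at this)
  obtain ⟨a', ha'⟩ := σ.exists_map_inl hs' (Set.mem_insert _ _) ha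
  refine ⟨s', hs', h.memT, ?_, h.domT, hi, h.posC, ?_⟩
  · rw [SetRel.dom_insert_pair]
    exact Set.insert_subset hs h.domS
  · rw [σ.rightSym_insert_inl ha ha']
    exact h.linked

/-- Extension by an event of `τ` in `C`. -/
theorem extend_right (h : PartialLift σ τ xS xT θ ω ν) {t : τ.S.E} (ht : t ∈ xT.1)
    (htd : t ∉ ν.dom) (hlow : ∀ r < t, r ∈ ν.dom) {c : C.E} (hc : τ.map t = Sum.inr c) :
    ∃ t', PartialLift σ τ xS xT θ ω (insert (t, t') ν) := by
  have hconf := isConf_insert xT.2 (τ.S.sym_family.conf_dom _ h.memT) h.domT ht hlow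
  obtain ⟨t', ht', hi⟩ := τ.extend_family (F := parFamily B.sym C.symP)
    (B.sym_family.dual.par C.symP_family)
    (fun _ h => ⟨h.1, h.2.1, C.symP_subset h.2.2⟩) h.memT h.posC htd hconf (by
      rintro hp (b | c') hg
      · have := hg.1 _ (Set.mem_insert _ _)
        simp [hc] at this
      · refine ⟨hg.1, hg.2.1, ?_⟩
        have h1 := hg.2.2
        rw [hc, relSnd_insert_inr] at h1 ⊢
        refine C.symP_ext _ h.posC.2.2 _ h1 (Set.subset_insert _ _) ?_
        rintro p ⟨rfl | hq, hq'⟩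
        · exact (τ.pol_inr hc).symm.trans hp
        · exact absurd hq hq')
  obtain ⟨c', hc'⟩ := τ.exists_map_inr ht' (Set.mem_insert _ _) hc
  refine ⟨t', h.memS, ht', h.domS, ?_, h.negA, hi, ?_⟩
  · rw [SetRel.dom_insert_pair]
    exact Set.insert_subset ht h.domT
  · rw [τ.leftSym_insert_inr hc hc']
    exact h.linked

/-- Extension by a synchronized pair of events. -/
theorem extend_mid (h : PartialLift σ τ xS xT θ ω ν)
    (hθ : Via B.sym θ (σ.right xS) (τ.left xT)) {s : σ.S.E} (hs : s ∈ xS.1)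
    (hsd : s ∉ ω.dom) (hlowS : ∀ r < s, r ∈ ω.dom) {t : τ.S.E} (ht : t ∈ xT.1)
    (htd : t ∉ ν.dom) (hlowT : ∀ r < t, r ∈ ν.dom) {b b' : B.E} (hb : σ.map s = Sum.inr b)
    (hb' : τ.map t = Sum.inl b') (hbb : (b, b') ∈ θ) :
    ∃ s' t', PartialLift σ τ xS xT θ (insert (s, s') ω) (insert (t, t') ν) := by
  have hcS := isConf_insert xS.2 (σ.S.sym_family.conf_dom _ h.memS) h.domS hs hlowS
  have hcT := isConf_insert xT.2 (τ.S.sym_family.conf_dom _ h.memT) h.domT ht hlowT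
  have hdS : (σ.rightSym ω).dom ⊆ θ.dom := hθ.2.1 ▸ σ.dom_rightSym_subset h.domS
  have hdT : (τ.leftSym ν).dom ⊆ θ.cod := hθ.2.2 ▸ τ.dom_leftSym_subset h.domT
  -- A pair over `B` leaves the `A`-part of `ω` and the `C`-part of `ν` unchanged, so only a common
  -- image `c` in `B` is needed.
  suffices ∃ s' t' c, insert (s, s') ω ∈ σ.S.sym ∧ insert (t, t') ν ∈ τ.S.sym ∧
      σ.map s' = Sum.inr c ∧ τ.map t' = Sum.inl c by
    obtain ⟨s', t', c, hs', ht', hc, hc'⟩ := this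
    refine ⟨s', t', hs', ht', ?_, ?_, ?_, ?_, ?_⟩
    · rw [SetRel.dom_insert_pair]
      exact Set.insert_subset hs h.domS
    · rw [SetRel.dom_insert_pair]
      exact Set.insert_subset ht h.domT
    · refine ⟨σ.imageSym_isLeft hs', ?_, σ.rightSym_mem hs'⟩
      change σ.leftSym _ ∈ _
      rw [σ.leftSym_insert_inr hb hc]
      exact h.negA.2.1
    · refine ⟨τ.imageSym_isLeft ht', τ.leftSym_mem ht', ?_⟩
      change τ.rightSym _ ∈ _
      rw [τ.rightSym_insert_inl hb' hc']
      exact h.posC.2.2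
    · rw [σ.rightSym_insert_inr hb hc, τ.leftSym_insert_inl hb' hc']
      exact h.linked.insert B.sym_family hθ.1 hbb
  -- The strategy for which the event is positive extends freely and thereby chooses `c`. The link
  -- along `θ` makes the corresponding extension a symmetry of `B` on the other side, where the
  -- event is negative and ∼-receptivity applies.
  rcases (σ.S.pol s).eq_pos_or_neg with hp | hp
  · obtain ⟨s', hs'⟩ := σ.S.sym_family.extend_one h.memS hsd hcS
    obtain ⟨c, hc⟩ := σ.exists_map_inr hs' (Set.mem_insert _ _) hb
    have h1 := σ.rightSym_mem hs'
    rw [σ.rightSym_insert_inr hb hc] at h1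
    have h2 := h.linked.insert_mem B.sym_family hθ.1 hbb hdS hdT h1
    obtain ⟨t', e, ht'⟩ := τ.extend_neg h.memT htd hcT
      (by rw [τ.pol_inl hb', ← B.sym_pol _ hθ.1 _ hbb, ← σ.pol_inr hb, hp]; rfl)
      (g' := Sum.inl c) (by
        have hi := τ.map_sym _ h.memT
        refine ⟨?_, ?_, ?_⟩
        · rintro p (rfl | hp)
          · simp [hb']
          · exact hi.1 p hp
        · rw [hb', relFst_insert_inl]
          exact h2
        · rw [hb', relSnd_insert_inl]
          exact hi.2.2)
    exact ⟨s', t', c, hs', ht', hc, e⟩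
  · obtain ⟨t', ht'⟩ := τ.S.sym_family.extend_one h.memT htd hcT
    obtain ⟨c, hc⟩ := τ.exists_map_inl ht' (Set.mem_insert _ _) hb'
    have h1 := τ.leftSym_mem ht'
    rw [τ.leftSym_insert_inl hb' hc] at h1
    have h2 := h.linked.symm.insert_mem B.sym_family (B.sym_family.inv_mem _ hθ.1) hbb hdT hdS h1
    obtain ⟨s', e, hs'⟩ := σ.extend_neg h.memS hsd hcS hp (g' := Sum.inr c) (by
        have hi := σ.map_sym _ h.memS
        refine ⟨?_, ?_, ?_⟩
        · rintro p (rfl | hp)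
          · simp [hb]
          · exact hi.1 p hp
        · rw [hb, relFst_insert_inr]
          exact hi.2.1
        · rw [hb, relSnd_insert_inr]
          exact h2)
    exact ⟨s', t', c, hs', ht', e, hc⟩

/-- The link along `θ` rules out half-processed synchronizations, so that when one component is
missing, `extend_mid` may add both. -/
theorem mem_dom_iff (h : PartialLift σ τ xS xT θ ω ν) {s : σ.S.E} (hs : s ∈ xS.1) {t : τ.S.E}
    (ht : t ∈ xT.1) {b b' : B.E} (hb : σ.map s = Sum.inr b) (hb' : τ.map t = Sum.inl b')
    (hbb : (b, b') ∈ θ) : s ∈ ω.dom ↔ t ∈ ν.dom := by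
  constructor
  · rintro ⟨s', hs'⟩
    obtain ⟨c, hc⟩ := σ.exists_map_inr h.memS hs' hb
    have := (h.linked b b' hbb c).1 (σ.mem_rightSym.2 ⟨s, s', hs', hb, hc⟩)
    obtain ⟨r, r', hr, e, -⟩ := τ.mem_leftSym.1 this
    exact τ.map_injOn _ xT.2 (h.domT ⟨_, hr⟩) ht (e.trans hb'.symm) ▸ ⟨_, hr⟩
  · rintro ⟨t', ht'⟩
    obtain ⟨c, hc⟩ := τ.exists_map_inl h.memT ht' hb'
    have := (h.linked b b' hbb c).2 (τ.mem_leftSym.2 ⟨t, t', ht', hb', hc⟩)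
    obtain ⟨r, r', hr, e, -⟩ := σ.mem_rightSym.1 this
    exact σ.map_injOn _ xS.2 (h.domS ⟨_, hr⟩) hs (e.trans hb.symm) ▸ ⟨_, hr⟩

/-- A partial lift which misses some event can be extended. -/
theorem exists_extend (h : PartialLift σ τ xS xT θ ω ν)
    (hθ : Via B.sym θ (σ.right xS) (τ.left xT)) (hsec : Secured (syncGraph σ τ xS xT θ))
    (hmiss : ω.dom ≠ xS.1 ∨ ν.dom ≠ xT.1) :
    ∃ ω' ν', PartialLift σ τ xS xT θ ω' ν' ∧ ω.dom ⊆ ω'.dom ∧ ν.dom ⊆ ν'.dom ∧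
      ¬ (ω'.dom ⊆ ω.dom ∧ ν'.dom ⊆ ν.dom) := by
  -- For a causally minimal missing event, all strict causes on both sides are already covered, and
  -- one of the three extension lemmas applies.
  obtain ⟨p, hp, hpm, hmin⟩ := hsec.exists_minimal finite_syncGraph
    (P := fun p => (∃ s, p.1 = Sum.inl s ∧ s ∉ ω.dom) ∨ ∃ t, p.2 = Sum.inr t ∧ t ∉ ν.dom) (by
      rcases hmiss with hm | hm
      · obtain ⟨s, hs, hsd⟩ := Set.exists_of_ssubset (h.domS.ssubset_of_ne hm)
        obtain ⟨p, hp, e⟩ := exists_event_left hθ hs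
        exact ⟨p, hp, Or.inl ⟨s, e, hsd⟩⟩
      · obtain ⟨t, ht, htd⟩ := Set.exists_of_ssubset (h.domT.ssubset_of_ne hm)
        obtain ⟨p, hp, e⟩ := exists_event_right hθ ht
        exact ⟨p, hp, Or.inr ⟨t, e, htd⟩⟩)
  have lowS : ∀ s ∈ xS.1, p.1 = Sum.inl s → ∀ r < s, r ∈ ω.dom := by
    intro s hs e r hr
    by_contra hn
    obtain ⟨q, hq, e'⟩ := exists_event_left hθ (xS.2.2 hr.le hs)
    exact hmin q ⟨hq, hp, Or.inl (by rw [e, e']; exact Sum.inl_lt_inl_iff.2 hr)⟩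
      (Or.inl ⟨r, e', hn⟩)
  have lowT : ∀ t ∈ xT.1, p.2 = Sum.inr t → ∀ r < t, r ∈ ν.dom := by
    intro t ht e r hr
    by_contra hn
    obtain ⟨q, hq, e'⟩ := exists_event_right hθ (xT.2.2 hr.le ht)
    exact hmin q ⟨hq, hp, Or.inr (by rw [e, e']; exact Sum.inr_lt_inr_iff.2 hr)⟩
      (Or.inr ⟨r, e', hn⟩)
  rcases hp with ⟨s, hs, a, ha, rfl⟩ | ⟨s, hs, t, ht, b, b', hb, hbb, hb', rfl⟩ |
    ⟨t, ht, c, hc, rfl⟩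
  · have hsd : s ∉ ω.dom := by simpa using hpm
    obtain ⟨s', h'⟩ := h.extend_left hs hsd (lowS s hs rfl) ha
    refine ⟨_, _, h', ?_, subset_rfl, ?_⟩ <;> rw [SetRel.dom_insert_pair]
    · exact Set.subset_insert _ _
    · exact fun hn => hsd (hn.1 (Set.mem_insert _ _))
  · have hiff := h.mem_dom_iff hs ht hb hb' hbb
    have hsd : s ∉ ω.dom := by
      rcases hpm with ⟨_, e, hn⟩ | ⟨_, e, hn⟩
      · cases e
        exact hn
      · cases e
        exact hiff.not.2 hn
    obtain ⟨s', t', h'⟩ := h.extend_mid hθ hs hsd (lowS s hs rfl) ht (hiff.not.1 hsd)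
      (lowT t ht rfl) hb hb' hbb
    refine ⟨_, _, h', ?_, ?_, ?_⟩ <;> rw [SetRel.dom_insert_pair]
    · exact Set.subset_insert _ _
    · exact Set.subset_insert _ _
    · exact fun hn => hsd (hn.1 (Set.mem_insert _ _))
  · have htd : t ∉ ν.dom := by simpa using hpm
    obtain ⟨t', h'⟩ := h.extend_right ht htd (lowT t ht rfl) hc
    refine ⟨_, _, h', subset_rfl, ?_, ?_⟩ <;> rw [SetRel.dom_insert_pair]
    · exact Set.subset_insert _ _
    · exact fun hn => htd (hn.2 (Set.mem_insert _ _))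

/-- Configurations which are causally compatible up to a symmetry on `B` are symmetric,
negatively on `A` and positively on `C`, to configurations which match on the nose. -/
theorem exists_total (hθ : Via B.sym θ (σ.right xS) (τ.left xT))
    (hsec : Secured (syncGraph σ τ xS xT θ)) :
    ∃ ω ν, PartialLift σ τ xS xT θ ω ν ∧ ω.dom = xS.1 ∧ ν.dom = xT.1 := by
  -- Maximality is taken over the pairs of domains, which are subsets of `xS` and `xT` and hence
  -- finitely many, whereas the lifts themselves may be infinitely many.
  have hfin : {D : Set σ.S.E × Set τ.S.E |
      ∃ ω ν, PartialLift σ τ xS xT θ ω ν ∧ D = (ω.dom, ν.dom)}.Finite := by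
    refine (xS.2.finite.finite_subsets.prod xT.2.finite.finite_subsets).subset ?_
    rintro _ ⟨ω, ν, h, rfl⟩
    exact ⟨h.domS, h.domT⟩
  obtain ⟨_, ⟨ω, ν, h, rfl⟩, hmax⟩ := hfin.exists_maximal ⟨_, ∅, ∅, empty, rfl⟩
  refine ⟨ω, ν, h, ?_⟩
  by_contra hn
  obtain ⟨ω', ν', h', h1, h2, h3⟩ := h.exists_extend hθ hsec (not_and_or.1 hn)
  exact h3 (hmax ⟨ω', ν', h', rfl⟩ ⟨h1, h2⟩)

end PartialLift

end Interaction

/-! ### Correspondence between pairs of witnesses and witnesses of the interaction -/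

section Interaction

open ESP

variable {A B C : TCG} {σ : Strategy (A.dual.par B)} {τ : Strategy (B.dual.par C)}

/-- Witnesses `w₁` and `w₂` are related to the witness `z` of the interaction when their
configurations are symmetric, compatibly with `Θ` on `B`. -/
def Related {rA : A.Conf} {rB : B.Conf} {rC : C.Conf} (w₁ : SimWit σ rA rB) (w₂ : SimWit τ rB rC)
    (z : SimInt σ τ rA rB rC) (Θ : SetRel B.E B.E) : Prop :=
  ∃ (ω : SetRel σ.S.E σ.S.E) (ν : SetRel τ.S.E τ.S.E),
    Via σ.S.sym ω w₁.x z.y.xS ∧ Via τ.S.sym ν w₂.x z.y.xT ∧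
    σ.leftSym ω ○ z.ψA = w₁.θA ∧ w₁.θB ○ Θ = σ.rightSym ω ∧
    w₂.θA ○ Θ = τ.leftSym ν ∧ τ.rightSym ν ○ z.ψC = w₂.θB

variable {rA : A.Conf} {rB : B.Conf} {rC : C.Conf}

/-- A compatible pair of witnesses is related to some witness of the interaction. -/
theorem exists_related {w₁ : SimWit σ rA rB} {w₂ : SimWit τ rB rC}
    (hw : CausallyCompatible w₁ w₂) :
    ∃ (z : SimInt σ τ rA rB rC) (Θ : SetRel B.E B.E),
      Via B.sym Θ rB (σ.right z.y.xS) ∧ Related w₁ w₂ z Θ := by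
  have hB₁ := w₁.pos.mono B.symP_subset
  have hB₂ := w₂.neg.mono B.symN_subset
  have hθ := B.sym_family.via_comp hB₁ (B.sym_family.via_inv hB₂)
  obtain ⟨ω, ν, h, hdS, hdT⟩ := PartialLift.exists_total hθ hw
  let yS : σ.S.Conf := ⟨ω.cod, σ.S.sym_family.conf_cod _ h.memS⟩
  let yT : τ.S.Conf := ⟨ν.cod, τ.S.sym_family.conf_cod _ h.memT⟩
  have hω : Via σ.S.sym ω w₁.x yS := ⟨h.memS, hdS, rfl⟩
  have hν : Via τ.S.sym ν w₂.x yT := ⟨h.memT, hdT, rfl⟩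
  have hωB := σ.via_right hω
  have hνB := τ.via_left hν
  have hωA : Via A.symN (σ.leftSym ω) (σ.left w₁.x) (σ.left yS) :=
    ⟨h.negA.2.1, (σ.via_left hω).2⟩
  have hνC : Via C.symP (τ.rightSym ν) (τ.right w₂.x) (τ.right yT) :=
    ⟨h.posC.2.2, (τ.via_right hν).2⟩
  have hlink : σ.rightSym ω = (w₁.θB ○ w₂.θA.inv) ○ τ.leftSym ν :=
    h.linked.eq_comp (by rw [hωB.2.1, hθ.2.1])
  have hmatch : σ.right yS = τ.left yT := by
    refine Subtype.ext ?_
    rw [← hωB.2.2, ← hνB.2.2, hlink]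
    exact SetRel.cod_comp_of_dom_subset (by rw [hθ.2.2, hνB.2.1])
  have hsec : Secured (syncGraph σ τ yS yT (idGraph (σ.right yS).1)) := by
    refine Secured.of_via (σ.S.sym_family.via_inv hω) (τ.S.sym_family.via_inv hν) ?_ hw
    rintro b b' c c' ⟨-, rfl : b = b'⟩ h1 h2
    rw [σ.rightSym_inv, hlink] at h1
    rw [τ.leftSym_inv] at h2
    obtain ⟨m, hm, hm'⟩ := h1
    obtain rfl := B.sym_family.fst_eq hνB.1 hm' h2
    exact hm
  let y : IntConf σ τ := ⟨yS, yT, hmatch, hsec⟩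
  have hΘ := B.sym_family.via_comp (B.sym_family.via_inv hB₁) hωB
  have hcov : y.PCovered := y.pCovered_iff.2
    ⟨σ.S.sym_family.pCovered_of_via σ.S.sym_pol hω w₁.covered,
      τ.S.sym_family.pCovered_of_via τ.S.sym_pol hν w₂.covered⟩
  -- The first, second and fourth equations dictate `ψA`, `Θ` and `ψC`; the third then holds because
  -- `ω` and `ν` are linked through `w₁.θB ○ w₂.θA.inv`.
  refine ⟨⟨(σ.leftSym ω).inv ○ w₁.θA, y, (τ.rightSym ν).inv ○ w₂.θB, hcov,
    A.symN_family.via_comp (A.symN_family.via_inv hωA) w₁.neg,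
    ⟨_, B.sym_family.via_inv hΘ⟩,
    C.symP_family.via_comp (C.symP_family.via_inv hνC) w₂.pos⟩,
    w₁.θB.inv ○ σ.rightSym ω, hΘ, ω, ν, hω, hν, ?_, ?_, ?_, ?_⟩
  · exact A.symN_family.cancel_left hωA.1 (by rw [w₁.neg.2.1, hωA.2.1])
  · exact B.sym_family.cancel_left hB₁.1 (by rw [hωB.2.1, hB₁.2.1])
  · rw [hlink, SetRel.comp_assoc, B.sym_family.cancel_left' hB₁.1,
      B.sym_family.cancel_left hB₂.1]
    · rw [hνB.2.1, hB₂.2.1]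
    · rw [SetRel.dom_comp_of_cod_subset, SetRel.dom_inv, hB₂.2.2, hB₁.2.2]
      rw [SetRel.cod_inv, hB₂.2.1, hνB.2.1]
  · exact C.symP_family.cancel_left hνC.1 (by rw [w₂.pos.2.1, hνC.2.1])

theorem SimInt.ext_of_eq {z z' : SimInt σ τ rA rB rC} (hS : z.y.xS = z'.y.xS)
    (hT : z.y.xT = z'.y.xT) (hA : z.ψA = z'.ψA) (hC : z.ψC = z'.ψC) : z = z' :=
  SimInt.ext hA (IntConf.ext hS hT) hC

/-- Two symmetries out of a common configuration which differ by an identity are equal. -/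
theorem ESP.Via.eq_of_inv_comp {S : ESP} {F : Set (SetRel S.E S.E)} {ω ω' : SetRel S.E S.E} {x y y' : S.Conf} (h : Via F ω x y) (h' : Via F ω' x y')
    (hid : ∀ p ∈ ω.inv ○ ω', p.1 = p.2) : ω = ω' ∧ y = y' := by
  have key : ω = ω' := by
    ext ⟨s, t⟩
    constructor
    · intro hs
      obtain ⟨t', ht'⟩ : s ∈ ω'.dom := h'.2.1.trans h.2.1.symm ▸ ⟨t, hs⟩
      obtain rfl : t = t' := hid (t, t') ⟨s, hs, ht'⟩
      exact ht'
    · intro hs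
      obtain ⟨t', ht'⟩ : s ∈ ω.dom := h.2.1.trans h'.2.1.symm ▸ ⟨t, hs⟩
      obtain rfl : t' = t := hid (t', t) ⟨s, ht', hs⟩
      exact ht'
  subst key
  exact ⟨rfl, Subtype.ext (h.2.2.symm.trans h'.2.2)⟩

/-- A pair of witnesses is related to at most one witness of the interaction. -/
theorem Related.right_unique {w₁ : SimWit σ rA rB} {w₂ : SimWit τ rB rC}
    {z z' : SimInt σ τ rA rB rC} {Θ Θ' : SetRel B.E B.E}
    (hΘ : Via B.sym Θ rB (σ.right z.y.xS)) (hΘ' : Via B.sym Θ' rB (σ.right z'.y.xS))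
    (h : Related w₁ w₂ z Θ) (h' : Related w₁ w₂ z' Θ') : z = z' ∧ Θ = Θ' := by
  obtain ⟨ω, ν, hω, hν, h1, h2, h3, h4⟩ := h
  obtain ⟨ω', ν', hω', hν', h1', h2', h3', h4'⟩ := h'
  have hα := σ.S.sym_family.via_comp (σ.S.sym_family.via_inv hω) hω'
  have hβ := τ.S.sym_family.via_comp (τ.S.sym_family.via_inv hν) hν'
  have hB₁ := w₁.pos.mono B.symP_subset
  have hB₂ := w₂.neg.mono B.symN_subset
  have eA : ∀ {ω : SetRel σ.S.E σ.S.E} {z : SimInt σ τ rA rB rC}, Via σ.S.sym ω w₁.x z.y.xS →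
      σ.leftSym ω ○ z.ψA = w₁.θA → σ.leftSym ω = w₁.θA ○ z.ψA.inv := by
    intro ω z hω h
    rw [← h, A.symN_family.cancel_right z.neg.1]
    rw [(σ.via_left hω).2.2, z.neg.2.1]
  have eC : ∀ {ν : SetRel τ.S.E τ.S.E} {z : SimInt σ τ rA rB rC}, Via τ.S.sym ν w₂.x z.y.xT →
      τ.rightSym ν ○ z.ψC = w₂.θB → τ.rightSym ν = w₂.θB ○ z.ψC.inv := by
    intro ν z hν h
    rw [← h, C.symP_family.cancel_right z.pos.1]
    rw [(τ.via_right hν).2.2, z.pos.2.1]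
  -- Rigidity applies to `ω.inv ○ ω'` and `ν.inv ○ ν'`: on `A` and `C` they are composites of
  -- negative, respectively positive, symmetries, and on `B` both equal `Θ.inv ○ Θ'`.
  have hid := z.y.eq_of_sym hα.1 hα.2.1 hβ.1 hβ.2.1 (by
      rw [σ.leftSym_comp (σ.S.sym_family.inv_mem _ hω.1)
        (by rw [SetRel.cod_inv, hω.2.1, hω'.2.1]), σ.leftSym_inv, eA hω h1, eA hω' h1']
      exact (A.symN_family.via_comp (A.symN_family.via_inv (A.symN_family.via_comp w₁.neg
        (A.symN_family.via_inv z.neg))) (A.symN_family.via_comp w₁.neg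
        (A.symN_family.via_inv z'.neg))).1) (by
      rw [τ.rightSym_comp (τ.S.sym_family.inv_mem _ hν.1)
        (by rw [SetRel.cod_inv, hν.2.1, hν'.2.1]), τ.rightSym_inv, eC hν h4, eC hν' h4']
      exact (C.symP_family.via_comp (C.symP_family.via_inv (C.symP_family.via_comp w₂.pos
        (C.symP_family.via_inv z.pos))) (C.symP_family.via_comp w₂.pos
        (C.symP_family.via_inv z'.pos))).1) (by
      rw [σ.rightSym_comp (σ.S.sym_family.inv_mem _ hω.1)
        (by rw [SetRel.cod_inv, hω.2.1, hω'.2.1]), σ.rightSym_inv,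
        τ.leftSym_comp (τ.S.sym_family.inv_mem _ hν.1)
        (by rw [SetRel.cod_inv, hν.2.1, hν'.2.1]), τ.leftSym_inv, ← h2, ← h2', ← h3, ← h3',
        SetRel.inv_comp, SetRel.inv_comp, SetRel.comp_assoc, SetRel.comp_assoc,
        B.sym_family.cancel_left' hB₁.1 (by rw [hΘ'.2.1, hB₁.2.2]),
        B.sym_family.cancel_left' hB₂.1 (by rw [hΘ'.2.1, hB₂.2.2])])
  obtain ⟨rfl, eS⟩ := hω.eq_of_inv_comp hω' hid.1
  obtain ⟨rfl, eT⟩ := hν.eq_of_inv_comp hν' hid.2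
  refine ⟨SimInt.ext_of_eq eS eT ?_ ?_, ?_⟩
  · rw [← A.sym_family.cancel_left' (σ.leftSym_mem hω.1) (χ := z.ψA)
      (by rw [z.neg.2.1, (σ.via_left hω).2.2]), h1, ← h1', A.sym_family.cancel_left'
      (σ.leftSym_mem hω.1) (by rw [z'.neg.2.1, (σ.via_left hω').2.2])]
  · rw [← C.sym_family.cancel_left' (τ.rightSym_mem hν.1) (χ := z.ψC)
      (by rw [z.pos.2.1, (τ.via_right hν).2.2]), h4, ← h4', C.sym_family.cancel_left'
      (τ.rightSym_mem hν.1) (by rw [z'.pos.2.1, (τ.via_right hν').2.2])]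
  · rw [← B.sym_family.cancel_left' hB₁.1 (χ := Θ) (by rw [hΘ.2.1, hB₁.2.2]), h2, ← h2',
      B.sym_family.cancel_left' hB₁.1 (by rw [hΘ'.2.1, hB₁.2.2])]

/-- A configuration whose image is symmetric to `rA ∥ rB` is symmetric to one for which this
symmetry is negative on `A` and positive on `B`. -/
theorem Strategy.exists_via_factorization (σ : Strategy (A.dual.par B)) (y : σ.S.Conf)
    {φ : SetRel A.E A.E} {ψ : SetRel B.E B.E} (hφ : Via A.sym φ (σ.left y) rA)
    (hψ : Via B.sym ψ (σ.right y) rB) :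
    ∃ (x : σ.S.Conf) (ω : SetRel σ.S.E σ.S.E), Via σ.S.sym ω x y ∧
      Via A.symN (σ.leftSym ω ○ φ) (σ.left x) rA ∧
      Via B.symP (σ.rightSym ω ○ ψ) (σ.right x) rB := by
  -- Positive on the game `A.dual.par B` means negative on `A` and positive on `B`. The
  -- factorization starts from `y`, so `ω` is the inverse of `θ`.
  obtain ⟨θ, hθ, hd, hP⟩ := σ.exists_factorization y.2 (φ.sum ψ)
    (sum_mem_parFamily hφ.1 hψ.1) (by
      ext (a | b)
      · rw [← Set.mem_preimage (f := Sum.inl), ← relFst_dom (by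
          rintro ⟨a | a, b | b⟩ hp <;> simp_all), relFst_sum, hφ.2.1]
        rfl
      · rw [← Set.mem_preimage (f := Sum.inr), ← relSnd_dom (by
          rintro ⟨a | a, b | b⟩ hp <;> simp_all), relSnd_sum, hψ.2.1]
        rfl)
  have hv : Via σ.S.sym θ.inv ⟨θ.cod, σ.S.sym_family.conf_cod _ hθ⟩ y :=
    ⟨σ.S.sym_family.inv_mem _ hθ, rfl, hd⟩
  have hl := σ.imageSym_isLeft hv.1
  rw [← σ.imageSym_inv] at hP
  have h1 := hP.2.1
  have h2 := hP.2.2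
  rw [relFst_comp hl, relFst_sum] at h1
  rw [relSnd_comp hl, relSnd_sum] at h2
  exact ⟨_, θ.inv, hv, ⟨h1, (A.sym_family.via_comp (σ.via_left hv) hφ).2⟩,
    ⟨h2, (B.sym_family.via_comp (σ.via_right hv) hψ).2⟩⟩

/-- Every witness of the interaction is related to some compatible pair of witnesses. -/
theorem exists_related_of_simInt (z : SimInt σ τ rA rB rC) {Θ : SetRel B.E B.E}
    (hΘ : Via B.sym Θ rB (σ.right z.y.xS)) :
    ∃ (w₁ : SimWit σ rA rB) (w₂ : SimWit τ rB rC),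
      CausallyCompatible w₁ w₂ ∧ Related w₁ w₂ z Θ := by
  have hΘ' : Via B.sym Θ rB (τ.left z.y.xT) := z.y.matching ▸ hΘ
  obtain ⟨xS, ω, hω, hωA, hωB⟩ := σ.exists_via_factorization z.y.xS
    (z.neg.mono A.symN_subset) (B.sym_family.via_inv hΘ)
  obtain ⟨xT, ν, hν, hνB, hνC⟩ := τ.exists_via_factorization z.y.xT
    (B.sym_family.via_inv hΘ') (z.pos.mono C.symP_subset)
  obtain ⟨hcS, hcT⟩ := z.y.pCovered_iff.1 z.covered
  refine ⟨⟨_, xS, _, σ.S.sym_family.pCovered_of_via σ.S.sym_pol (σ.S.sym_family.via_inv hω) hcS,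
    hωA, hωB⟩, ⟨_, xT, _, τ.S.sym_family.pCovered_of_via τ.S.sym_pol
    (τ.S.sym_family.via_inv hν) hcT, hνB, hνC⟩, ?_, ω, ν, hω, hν, rfl, ?_, ?_, rfl⟩
  -- In the symmetry between the two projections to `B`, the legs `Θ.inv` and `Θ` cancel, so that it
  -- corresponds under `ω` and `ν` to the identity on `y_B`.
  · refine Secured.of_via hω hν ?_ z.y.compatible
    rintro b b' c c' ⟨m, ⟨d, hd, hdm⟩, ⟨d', hd', hdm'⟩⟩ hc hc'
    obtain rfl := B.sym_family.snd_eq (σ.rightSym_mem hω.1) hc hd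
    obtain rfl := B.sym_family.snd_eq (τ.leftSym_mem hν.1) hc' hd'
    exact ⟨hΘ.2.2 ▸ ⟨m, hdm⟩, B.sym_family.snd_eq hΘ.1 hdm hdm'⟩
  · exact B.sym_family.cancel_right' hΘ.1 (by rw [(σ.via_right hω).2.2, hΘ.2.2])
  · exact B.sym_family.cancel_right' hΘ.1 (by rw [(τ.via_left hν).2.2, hΘ'.2.2])

/-- A witness is determined by a symmetry to a given configuration which it induces on the
components together with given symmetries to the representatives. -/
theorem SimWit.eq_of_via {A B : TCG} {σ : Strategy (A.dual.par B)} {rA : A.Conf} {rB : B.Conf}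
    {w w' : SimWit σ rA rB} {y : σ.S.Conf} {ω ω' : SetRel σ.S.E σ.S.E} {φ : SetRel A.E A.E}
    {Θ : SetRel B.E B.E} (hω : Via σ.S.sym ω w.x y) (hω' : Via σ.S.sym ω' w'.x y)
    (hφ : Via A.sym φ (σ.left y) rA) (hΘ : Via B.sym Θ rB (σ.right y))
    (h1 : σ.leftSym ω ○ φ = w.θA) (h1' : σ.leftSym ω' ○ φ = w'.θA)
    (h2 : w.θB ○ Θ = σ.rightSym ω) (h2' : w'.θB ○ Θ = σ.rightSym ω') : w = w' := by
  have hα := σ.S.sym_family.via_comp hω (σ.S.sym_family.via_inv hω')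
  have hd : ω'.inv.dom ⊆ ω.cod := by rw [SetRel.dom_inv, hω'.2.2, hω.2.2]
  -- The components of `ω ○ ω'.inv` are `w.θA ○ w'.θA.inv`, negative, and `w.θB ○ w'.θB.inv`,
  -- positive: its image is a positive symmetry of `A.dual.par B`.
  have hid := σ.eq_of_imageSym_symP hα.1 ⟨σ.imageSym_isLeft hα.1, by
    change σ.leftSym _ ∈ A.symN
    have := (A.symN_family.via_comp w.neg (A.symN_family.via_inv w'.neg)).1
    rwa [← h1, ← h1', SetRel.inv_comp, ← SetRel.comp_assoc, A.sym_family.cancel_right hφ.1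
      (by rw [(σ.via_left hω).2.2, hφ.2.1]), ← σ.leftSym_inv, ← σ.leftSym_comp hω.1 hd] at this, by
    change σ.rightSym _ ∈ B.symP
    have := (B.symP_family.via_comp w.pos (B.symP_family.via_inv w'.pos)).1
    rwa [σ.rightSym_comp hω.1 hd, σ.rightSym_inv, ← h2, ← h2', SetRel.inv_comp,
      ← SetRel.comp_assoc, B.sym_family.cancel_right hΘ.1 (by rw [w.pos.2.2, hΘ.2.1])]⟩
  obtain ⟨e, ex⟩ := (σ.S.sym_family.via_inv hω).eq_of_inv_comp
    (σ.S.sym_family.via_inv hω') hid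
  obtain rfl : ω = ω' := congrArg SetRel.inv e
  refine SimWit.ext (h1.symm.trans h1') ex ?_
  rw [← B.sym_family.cancel_right hΘ.1 (χ := w.θB) (by rw [w.pos.2.2, hΘ.2.1]), h2, ← h2',
    B.sym_family.cancel_right hΘ.1 (by rw [w'.pos.2.2, hΘ.2.1])]

/-- A witness of the interaction is related to at most one pair of witnesses. -/
theorem Related.left_unique {w₁ w₁' : SimWit σ rA rB} {w₂ w₂' : SimWit τ rB rC}
    {z : SimInt σ τ rA rB rC} {Θ : SetRel B.E B.E} (hΘ : Via B.sym Θ rB (σ.right z.y.xS))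
    (h : Related w₁ w₂ z Θ) (h' : Related w₁' w₂' z Θ) : w₁ = w₁' ∧ w₂ = w₂' := by
  obtain ⟨ω, ν, hω, hν, h1, h2, h3, h4⟩ := h
  obtain ⟨ω', ν', hω', hν', h1', h2', h3', h4'⟩ := h'
  have hΘ' : Via B.sym Θ rB (τ.left z.y.xT) := z.y.matching ▸ hΘ
  refine ⟨SimWit.eq_of_via hω hω' (z.neg.mono A.symN_subset) hΘ h1 h1' h2 h2', ?_⟩
  have hψ := z.pos.mono C.symP_subset
  -- For `τ` the game `B` is on the left, so `Θ.inv` is the symmetry to the representative there,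
  -- and the inverse of `ψC` is the one out of the representative on the right.
  refine SimWit.eq_of_via hν hν' (B.sym_family.via_inv hΘ') (C.sym_family.via_inv hψ)
    ?_ ?_ ?_ ?_
  · rw [← h3, B.sym_family.cancel_right hΘ.1 (by rw [w₂.neg.2.2, hΘ.2.1])]
  · rw [← h3', B.sym_family.cancel_right hΘ.1 (by rw [w₂'.neg.2.2, hΘ.2.1])]
  · rw [← h4, C.sym_family.cancel_right hψ.1 (by rw [(τ.via_right hν).2.2, hψ.2.1])]
  · rw [← h4', C.sym_family.cancel_right hψ.1 (by rw [(τ.via_right hν').2.2, hψ.2.1])]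

/-! ### Transport of endosymmetries -/

variable {κ : B.Conf → SetRel B.E B.E} {r x : B.Conf}

theorem via_transport {φ : SetRel B.E B.E} (hr : Via B.sym (κ r) r r)
    (hx : Via B.sym (κ x) x r) (hφ : Via B.sym φ r r) : Via B.sym (transport κ φ r x) r x :=
  B.sym_family.via_comp (B.sym_family.via_comp hr hφ) (B.sym_family.via_inv hx)

/-- Transport is a bijection between the endosymmetries of the representative and the symmetries
from the representative to a given configuration. -/
theorem exists_transport_eq {Θ : SetRel B.E B.E} (hr : Via B.sym (κ r) r r)
    (hx : Via B.sym (κ x) x r) (hΘ : Via B.sym Θ r x) :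
    ∃ φ, Via B.sym φ r r ∧ transport κ φ r x = Θ := by
  have h1 := B.sym_family.via_comp hΘ hx
  refine ⟨(κ r).inv ○ (Θ ○ κ x), B.sym_family.via_comp (B.sym_family.via_inv hr) h1, ?_⟩
  rw [transport, B.sym_family.cancel_left hr.1 (by rw [h1.2.1, hr.2.1]),
    B.sym_family.cancel_right hx.1 (by rw [hΘ.2.2, hx.2.1])]

theorem transport_injective {φ φ' : SetRel B.E B.E} (hr : Via B.sym (κ r) r r)
    (hx : Via B.sym (κ x) x r) (hφ : Via B.sym φ r r) (hφ' : Via B.sym φ' r r)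
    (h : transport κ φ r x = transport κ φ' r x) : φ = φ' := by
  have key : ∀ {φ : SetRel B.E B.E}, Via B.sym φ r r →
      (κ r).inv ○ (transport κ φ r x ○ κ x) = φ := by
    intro φ hφ
    rw [transport, B.sym_family.cancel_right' hx.1
      (by rw [(B.sym_family.via_comp hr hφ).2.2, hx.2.2]),
      B.sym_family.cancel_left' hr.1 (by rw [hφ.2.1, hr.2.2])]
  rw [← key hφ, h, key hφ']

end Interaction

/-! ### The bijection -/

theorem mainTheorem3 {A B C : TCG} (σ : Strategy (A.dual.par B)) (τ : Strategy (B.dual.par C))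
    (repA : A.SymClass → A.Conf) (hrepA : ∀ x, A.symClass (repA x) = x)
    (repB : B.SymClass → B.Conf) (hrepB : ∀ x, B.symClass (repB x) = x)
    (repC : C.SymClass → C.Conf) (hrepC : ∀ x, C.symClass (repC x) = x)
    (xA : A.SymClass) (xB : B.SymClass) (xC : C.SymClass)
    (κ : B.Conf → SetRel B.E B.E)
    (hκ : ∀ x, B.symClass x = xB → ESP.Via B.sym (κ x) x (repB xB)) :
    ∃ Υ : CompatiblePairs σ τ (repA xA) (repB xB) (repC xC) ≃
        SimInt σ τ (repA xA) (repB xB) (repC xC) × B.EndoSym (repB xB),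
      ∀ w : CompatiblePairs σ τ (repA xA) (repB xB) (repC xC),
        let w₁ := w.1.1
        let w₂ := w.1.2
        let z := (Υ w).1
        let φ := (Υ w).2
        let yB := σ.right z.y.xS
        let Θ := transport κ φ.1 (repB xB) yB
        ∃ (ω : SetRel σ.S.E σ.S.E) (ν : SetRel τ.S.E τ.S.E),
          ESP.Via σ.S.sym ω w₁.x z.y.xS ∧
          ESP.Via τ.S.sym ν w₂.x z.y.xT ∧
          σ.leftSym ω ○ z.ψA = w₁.θA ∧
          w₁.θB ○ Θ = σ.rightSym ω ∧
          w₂.θA ○ Θ = τ.leftSym ν ∧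
          τ.rightSym ν ○ z.ψC = w₂.θB := by
  have hr : ESP.Via B.sym (κ (repB xB)) (repB xB) (repB xB) := hκ _ (hrepB xB)
  -- The component `mid` places `y_B` in the class `xB`, where `κ` is known to be a symmetry to the
  -- representative.
  have hy : ∀ z : SimInt σ τ (repA xA) (repB xB) (repC xC),
      ESP.Via B.sym (κ (σ.right z.y.xS)) (σ.right z.y.xS) (repB xB) := fun z =>
    hκ _ ((Quotient.sound z.mid : B.symClass _ = B.symClass _).trans (hrepB xB))
  have hex : ∀ w : CompatiblePairs σ τ (repA xA) (repB xB) (repC xC),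
      ∃ p : SimInt σ τ (repA xA) (repB xB) (repC xC) × B.EndoSym (repB xB),
        Related w.1.1 w.1.2 p.1 (transport κ p.2.1 (repB xB) (σ.right p.1.y.xS)) := by
    intro w
    obtain ⟨z, Θ, hΘ, h⟩ := exists_related w.2
    obtain ⟨φ, hφ, rfl⟩ := exists_transport_eq hr (hy z) hΘ
    exact ⟨(z, ⟨φ, hφ⟩), h⟩
  choose f hf using hex
  have hbij : Function.Bijective f := by
    constructor
    · intro w w' e
      have h := hf w
      rw [e] at h
      obtain ⟨e1, e2⟩ := Related.left_unique
        (via_transport hr (hy (f w').1) (f w').2.2) h (hf w')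
      exact Subtype.ext (Prod.ext e1 e2)
    · rintro ⟨z, φ, hφ⟩
      obtain ⟨w₁, w₂, hw, h⟩ := exists_related_of_simInt z (via_transport hr (hy z) hφ)
      refine ⟨⟨(w₁, w₂), hw⟩, ?_⟩
      have h' := hf ⟨(w₁, w₂), hw⟩
      revert h'
      -- With the value of `f` made a variable, `z'` can be identified with `z`; the two transports
      -- then have the same target and injectivity applies.
      generalize f ⟨(w₁, w₂), hw⟩ = p
      obtain ⟨z', φ', hφ'⟩ := p
      intro h'
      obtain ⟨rfl, e⟩ := Related.right_unique (via_transport hr (hy z') hφ')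
        (via_transport hr (hy z) hφ) h' h
      exact Prod.ext rfl (Subtype.ext (transport_injective hr (hy z') hφ' hφ e))
  exact ⟨Equiv.ofBijective f hbij, hf⟩
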